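/- **Setting.** Let $z_b\in\mathbb R^n$, let $B^\infty\in\mathbb R^{n\times n}$ and $R\in\mathbb R^{m\times m}$ be symmetric positive definite, let $y\in\mathbb R^m$, and let $\mathcal H:\mathbb R^n\to\mathbb R^m$ be continuously differentiable. Write $\|x\|_A^2=x^\top Ax$ and $$f(x)=\tfrac12\|x-z_b\|^2_{(B^\infty)^{-1}}+\tfrac12\|y-\mathcal H(x)\|^2_{R^{-1}} .$$ An *ensemble* consists of $N$ independent samples $\hat z^1,\dots,\hat z^N$ of the Gaussian $N(z_b,B^\infty)$, and $B^N=\frac1{N-1}\sum_{k=1}^N(\hat z^k-z_b)(\hat z^k-z_b)^\top$ is its empirical covariance. Consider a run of the following Levenberg–Marquardt method, with constants $\eta_1\in(0,1)$, $\eta_2,\mu_{\min}>0$, $\lambda>1$, $\mu_0\ge\mu_{\min}$ and a deterministic starting point $X_0=x_0$, $u_0=\mu_0$. At iteration $j$: 1. a fresh ensemble with empirical covariance $B^N$ is drawn, and the model is $$M_j(X_j+s)=\tfrac12\|X_j+s-z_b\|^2_{(B^N)^{-1}}+\tfrac12\|y-\mathcal H(X_j)-\mathcal H'(X_j)s\|^2_{R^{-1}}+\tfrac12u_j\|g_{M_j}\|\,\|s\|^2,$$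 where $g_{M_j}=(B^N)^{-1}(X_j-z_b)+\mathcal H'(X_j)^\top R^{-1}(\mathcal H(X_j)-y)$ is its gradient at $s=0$; 2. a step $S_j$ is computed; it is $\mathcal F_{j-1/2}$-measurable; 3. a fresh ensemble is drawn, with empirical covariance again denoted $B^N$, and $F^0_j=\tfrac12\|X_j-z_b\|^2_{(B^N)^{-1}}+\tfrac12\|y-\mathcal H(X_j)\|^2_{R^{-1}}$ and $F^1_j$ (the same expression at $X_j+S_j$) are computed; 4. if $\frac{F^0_j-F^1_j}{M_j(X_j)-M_j(X_j+S_j)}\ge\eta_1$ and $\|g_{M_j}\|\ge\eta_2/u_j$, then $X_{j+1}=X_j+S_j$ and $u_{j+1}=\max\{u_j/\lambda,\mu_{\min}\}$; otherwise $X_{j+1}=X_j$ and $u_{j+1}=\lambda u_j$. (In step 4 a ratio with zero denominator counts as $0$.) The run is stopped at the first $j$ with $u_j>\mu_{\max}$. Here $\mathcal F_{j-1}$ is the $\sigma$-algebra generated by the models $M_i$ and the estimates $F^0_i,F^1_i$ with $i<j$, and $\mathcal F_{j-1/2}$ is generated by $\mathcal F_{j-1}$ and $M_j$. The first ensemble of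 iteration $j$ is independent of $\mathcal F_{j-1}$, and the second one is independent of $\mathcal F_{j-1/2}$. Let $\varepsilon_f,\kappa_{ef},\kappa_{eg}>0$ and $$U_j=\Big\{\|g_{M_j}-\nabla f(X_j)\|\le\tfrac{\kappa_{eg}}{u_j},\ |f(X_j)-M_j(X_j)|\le\tfrac{\kappa_{ef}}{u_j^2}\Big\},$$ $$V_j=\Big\{|F^0_j-f(X_j)|\le\tfrac{\varepsilon_f}{u_j^2},\ |F^1_j-f(X_j+S_j)|\le\tfrac{\varepsilon_f}{u_j^2}\Big\},$$ $$p_j^*=\Pr(U_j\mid\mathcal F_{j-1}),\qquad q_j^*=\Pr(V_j\mid\mathcal F_{j-1/2}).$$ Put $c_j=\min\{\lambda^j\mu_0,\mu_{\max}\}$ and $$\aleph_j=\max\Big\{\tfrac{\|X_j-z_b\|^2_{(B^\infty)^{-1}}}{2\varepsilon_f},\ \tfrac{\|X_j+S_j-z_b\|^2_{(B^\infty)^{-1}}}{2\varepsilon_f},\ \tfrac{\|X_j-z_b\|^2_{(B^\infty)^{-1}}}{2\kappa_{ef}},\ \tfrac{\|(B^\infty)^{-1}(X_j-z_b)\|}{\kappa_{eg}c_j}\Big\},$$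 $$\Theta_j=\tfrac{2\varepsilon_f}{c_j^2}-\tfrac{n}{N-1-n}\|X_j-z_b\|^2_{(B^\infty)^{-1}},\qquad \tilde\Theta_j=\tfrac{2\varepsilon_f}{c_j^2}-\tfrac{n}{N-1-n}\|X_j+S_j-z_b\|^2_{(B^\infty)^{-1}},$$ $$\Upsilon_j=\tfrac{2\kappa_{ef}}{c_j^2}-\tfrac{n}{N-1-n}\|X_j-z_b\|^2_{(B^\infty)^{-1}},\qquad \tilde\Upsilon_j=\tfrac{\kappa_{eg}}{c_j}-\tfrac{n}{N-1-n}\|(B^\infty)^{-1}(X_j-z_b)\|.$$ **Statement.** For every $j$, almost surely, if iteration $j$ is reached (that is, $u_i\le\mu_{\max}$ for all $i\le j$) and $$N>(\aleph_j\,c_j^2+1)\,n+1,$$ then $$q_j^*\ \ge\ 1-\frac{\operatorname{Var}\|X_j-z_b\|^2_{(B^N)^{-1}}}{\Theta_j^2}-\frac{\operatorname{Var}\|X_j+S_j-z_b\|^2_{(B^N)^{-1}}}{\tilde\Theta_j^2}$$ and $$p_j^*\ \ge\ 1-\frac{\operatorname{Var}\|X_j-z_b\|^2_{(B^N)^{-1}}}{\Upsilon_j^2}-\frac{n\,\lambda_{\max}}{\tilde\Upsilon_j^2},$$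 where $\lambda_{\max}$ is the largest eigenvalue of $\operatorname{Cov}\big((B^N)^{-1}(X_j-z_b)\big)$. The variances and the covariance are those with $X_j$ and $S_j$ held fixed, the randomness being that of the ensemble; a variance, or $\lambda_{\max}$, is $+\infty$ (and the bound is then trivial) when the second moments are not finite. -/

import Mathlib

open MeasureTheory ProbabilityTheory
open scoped Matrix ENNReal

noncomputable section

namespace EnsembleLM

/-- The squared weighted norm `‖x‖²_A = xᵀ A x`. -/
def wsq {n : ℕ} (A : Matrix (Fin n) (Fin n) ℝ) (x : EuclideanSpace ℝ (Fin n)) : ℝ :=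
  x.ofLp ⬝ᵥ (A *ᵥ x.ofLp)

/-- The vector `A x` as an element of Euclidean space. -/
def mulE {n : ℕ} (A : Matrix (Fin n) (Fin n) ℝ) (x : EuclideanSpace ℝ (Fin n)) :
    EuclideanSpace ℝ (Fin n) :=
  WithLp.toLp 2 (A *ᵥ x.ofLp)

/-- The empirical covariance `B^N = (1/(N-1)) ∑ₖ (ẑᵏ - z_b)(ẑᵏ - z_b)ᵀ` of an ensemble. -/
def empCov {n N : ℕ} (zb : EuclideanSpace ℝ (Fin n)) (Z : Fin N → EuclideanSpace ℝ (Fin n)) :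
    Matrix (Fin n) (Fin n) ℝ :=
  ((N : ℝ) - 1)⁻¹ • ∑ k, Matrix.vecMulVec (Z k - zb).ofLp (Z k - zb).ofLp

/-- The data of a strong-constraint 4DVAR problem: prior mean `z_b`, prior covariance `B^∞`,
observation covariance `R`, observations `y`, and the (nonlinear, continuously differentiable)
observation operator `ℋ`. -/
structure Problem (n m : ℕ) where
  zb : EuclideanSpace ℝ (Fin n)
  Binf : Matrix (Fin n) (Fin n) ℝ
  Binf_posDef : Binf.PosDef
  R : Matrix (Fin m) (Fin m) ℝ
  R_posDef : R.PosDef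
  y : EuclideanSpace ℝ (Fin m)
  obs : EuclideanSpace ℝ (Fin n) → EuclideanSpace ℝ (Fin m)
  obs_contDiff : ContDiff ℝ 1 obs

namespace Problem

variable {n m : ℕ} (D : Problem n m)

/-- `½ ‖x - z_b‖²_{B⁻¹} + ½ ‖y - ℋ(x)‖²_{R⁻¹}`, for a covariance matrix `B`. -/
def cost (B : Matrix (Fin n) (Fin n) ℝ) (x : EuclideanSpace ℝ (Fin n)) : ℝ :=
  (1 / 2) * wsq B⁻¹ (x - D.zb) + (1 / 2) * wsq D.R⁻¹ (D.y - D.obs x)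

/-- The exact objective `f`, which uses the true covariance `B^∞`. -/
def f (x : EuclideanSpace ℝ (Fin n)) : ℝ := D.cost D.Binf x

/-- The Gauss-Newton model at `x`, as a function of the step `s`:
`½ ‖s + x - z_b‖²_{B⁻¹} + ½ ‖y - ℋ(x) - ℋ'(x) s‖²_{R⁻¹}`. -/
def gnModel (B : Matrix (Fin n) (Fin n) ℝ) (x s : EuclideanSpace ℝ (Fin n)) : ℝ :=
  (1 / 2) * wsq B⁻¹ (s + x - D.zb)
    + (1 / 2) * wsq D.R⁻¹ (D.y - D.obs x - fderiv ℝ D.obs x s)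

/-- The model gradient at the zero step. (The regularization term `½ γ ‖s‖²`, whose coefficient
`γ` is itself defined from this gradient, does not contribute to it.) -/
def modelGrad (B : Matrix (Fin n) (Fin n) ℝ) (x : EuclideanSpace ℝ (Fin n)) :
    EuclideanSpace ℝ (Fin n) :=
  gradient (D.gnModel B x) 0

/-- The regularized model, as a function of the step `s`, with `γ = μ ‖g‖`. -/
def model (B : Matrix (Fin n) (Fin n) ℝ) (x : EuclideanSpace ℝ (Fin n)) (μ : ℝ)
    (s : EuclideanSpace ℝ (Fin n)) : ℝ :=
  D.gnModel B x s + (1 / 2) * (μ * ‖D.modelGrad B x‖) * ‖s‖ ^ 2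

/-- The law of an ensemble: `N` independent samples from the Gaussian `N(z_b, B^∞)`. -/
def ensembleLaw (N : ℕ) : Measure (Fin N → EuclideanSpace ℝ (Fin n)) :=
  Measure.pi fun _ => multivariateGaussian D.zb D.Binf

/-- `Var ‖x - z_b‖²_{(B^N)⁻¹}` for a fixed point `x`, the randomness being that of the ensemble.
It takes the value `∞` when there is no finite second moment. -/
def varNormSq (N : ℕ) (x : EuclideanSpace ℝ (Fin n)) : ℝ≥0∞ :=
  evariance (fun Z : Fin N → EuclideanSpace ℝ (Fin n) => wsq (empCov D.zb Z)⁻¹ (x - D.zb))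
    (D.ensembleLaw N)

/-- The matrix `Cov((B^N)⁻¹ (x - z_b))` for a fixed point `x`. -/
def covPrec (N : ℕ) (x : EuclideanSpace ℝ (Fin n)) : Matrix (Fin n) (Fin n) ℝ :=
  Matrix.of fun i k => covariance
    (fun Z : Fin N → EuclideanSpace ℝ (Fin n) => mulE (empCov D.zb Z)⁻¹ (x - D.zb) i)
    (fun Z : Fin N → EuclideanSpace ℝ (Fin n) => mulE (empCov D.zb Z)⁻¹ (x - D.zb) k)
    (D.ensembleLaw N)

open Classical in
/-- The largest eigenvalue `λ_max` of `Cov((B^N)⁻¹ (x - z_b))`; it is `∞` when this random vector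
has no finite second moments, i.e. when the covariance matrix does not exist. -/
def lamMax (N : ℕ) (x : EuclideanSpace ℝ (Fin n)) : ℝ≥0∞ :=
  if ∀ i, MemLp (fun Z : Fin N → EuclideanSpace ℝ (Fin n) =>
      mulE (empCov D.zb Z)⁻¹ (x - D.zb) i) 2 (D.ensembleLaw N)
  then ENNReal.ofReal (sSup (spectrum ℝ (D.covPrec N x)))
  else ∞

/-- `ℵ_j`, at `X_j = x`, `S_j = s`, with `c = min {λʲ μ₀, μ_max}`. -/
def aleph (εf κef κeg c : ℝ) (x s : EuclideanSpace ℝ (Fin n)) : ℝ :=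
  max (max (wsq D.Binf⁻¹ (x - D.zb) / (2 * εf)) (wsq D.Binf⁻¹ (x + s - D.zb) / (2 * εf)))
    (max (wsq D.Binf⁻¹ (x - D.zb) / (2 * κef)) (‖mulE D.Binf⁻¹ (x - D.zb)‖ / (κeg * c)))

/-- `2 κ / c² - n / (N - 1 - n) * ‖x - z_b‖²_{(B^∞)⁻¹}`: this is `Θ_j`, `Θ̃_j` and `Υ_j` for
`(κ, x) = (ε_f, X_j)`, `(ε_f, X_j + S_j)` and `(κ_ef, X_j)`. -/
def valueThreshold (N : ℕ) (κ c : ℝ) (x : EuclideanSpace ℝ (Fin n)) : ℝ :=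
  2 * κ / c ^ 2 - (n : ℝ) / ((N : ℝ) - 1 - n) * wsq D.Binf⁻¹ (x - D.zb)

/-- `Υ̃_j = κ_eg / c - n / (N - 1 - n) * ‖(B^∞)⁻¹ (x - z_b)‖`. -/
def gradThreshold (N : ℕ) (κeg c : ℝ) (x : EuclideanSpace ℝ (Fin n)) : ℝ :=
  κeg / c - (n : ℝ) / ((N : ℝ) - 1 - n) * ‖mulE D.Binf⁻¹ (x - D.zb)‖

end Problem

/-- The algorithmic constants of the Levenberg-Marquardt method. -/
structure Params where
  eta1 : ℝ
  eta2 : ℝ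
  muMin : ℝ
  lam : ℝ
  mu0 : ℝ
  eta1_pos : 0 < eta1
  eta1_lt_one : eta1 < 1
  eta2_pos : 0 < eta2
  muMin_pos : 0 < muMin
  one_lt_lam : 1 < lam
  muMin_le_mu0 : muMin ≤ mu0

/-- The random quantities of a run: iterates `X_j`, steps `S_j`, regularization parameters `u_j`,
the ensemble `Zm_j` from which the model of iteration `j` is built, and the ensemble `Zf_j` from
which the function estimates of iteration `j` are computed. -/
structure Trajectory (n N : ℕ) (Ω : Type*) where
  X : ℕ → Ω → EuclideanSpace ℝ (Fin n)
  S : ℕ → Ω → EuclideanSpace ℝ (Fin n)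
  u : ℕ → Ω → ℝ
  Zm : ℕ → Ω → Fin N → EuclideanSpace ℝ (Fin n)
  Zf : ℕ → Ω → Fin N → EuclideanSpace ℝ (Fin n)

namespace Trajectory

variable {n m N : ℕ} {Ω : Type*} (T : Trajectory n N Ω) (D : Problem n m)

/-- The random model `M_j`, as a function of the step: `s ↦ M_j(X_j + s)`. -/
def M (j : ℕ) (ω : Ω) (s : EuclideanSpace ℝ (Fin n)) : ℝ :=
  D.model (empCov D.zb (T.Zm j ω)) (T.X j ω) (T.u j ω) s

/-- The random model gradient `g_{M_j}`. -/
def g (j : ℕ) (ω : Ω) : EuclideanSpace ℝ (Fin n) :=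
  D.modelGrad (empCov D.zb (T.Zm j ω)) (T.X j ω)

/-- The estimate `F⁰_j` of `f(X_j)`. -/
def F0 (j : ℕ) (ω : Ω) : ℝ := D.cost (empCov D.zb (T.Zf j ω)) (T.X j ω)

/-- The estimate `F¹_j` of `f(X_j + S_j)`. -/
def F1 (j : ℕ) (ω : Ω) : ℝ := D.cost (empCov D.zb (T.Zf j ω)) (T.X j ω + T.S j ω)

/-- The ratio `ρ_j` of estimated to predicted decrease. -/
def rho (j : ℕ) (ω : Ω) : ℝ :=
  (T.F0 D j ω - T.F1 D j ω) / (T.M D j ω 0 - T.M D j ω (T.S j ω))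

/-- Iteration `j` is successful: `ρ_j ≥ η₁` and `‖g_{M_j}‖ ≥ η₂ / u_j`. -/
def Success (A : Params) (j : ℕ) (ω : Ω) : Prop :=
  A.eta1 ≤ T.rho D j ω ∧ A.eta2 / T.u j ω ≤ ‖T.g D j ω‖

/-- The σ-algebra `ℱ_{j-1}` generated by the models and the function estimates of all iterations
before the `j`-th: `M_0, …, M_{j-1}, F⁰_0, F¹_0, …, F⁰_{j-1}, F¹_{j-1}`. -/
def past (j : ℕ) : MeasurableSpace Ω :=
  ⨆ i : Fin j, MeasurableSpace.comap (T.M D i) inferInstance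
    ⊔ (MeasurableSpace.comap (T.F0 D i) inferInstance
      ⊔ MeasurableSpace.comap (T.F1 D i) inferInstance)

/-- The σ-algebra `ℱ_{j-1/2}` generated by `ℱ_{j-1}` and the model `M_j`. -/
def pastHalf (j : ℕ) : MeasurableSpace Ω :=
  T.past D j ⊔ MeasurableSpace.comap (T.M D j) inferInstance

open Classical in
/-- `T` is a run, started at `x0`, of the Levenberg-Marquardt method on the problem `D`.
The step is computed (in any way) from the information available once the model is known, and
each ensemble is a fresh Gaussian sample: given what was computed before it is drawn, the only
randomness left in the model (respectively in the function estimates) is that of the ensemble. -/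
structure IsRun [MeasurableSpace Ω] (A : Params) (x0 : EuclideanSpace ℝ (Fin n))
    (P : Measure Ω) : Prop where
  X_zero : ∀ ω, T.X 0 ω = x0
  u_zero : ∀ ω, T.u 0 ω = A.mu0
  X_succ : ∀ j ω, T.X (j + 1) ω =
    if T.Success D A j ω then T.X j ω + T.S j ω else T.X j ω
  u_succ : ∀ j ω, T.u (j + 1) ω =
    if T.Success D A j ω then max (T.u j ω / A.lam) A.muMin else A.lam * T.u j ω
  measurable_S : ∀ j, Measurable[T.pastHalf D j] (T.S j)
  measurable_Zm : ∀ j, Measurable (T.Zm j)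
  measurable_Zf : ∀ j, Measurable (T.Zf j)
  law_Zm : ∀ j, P.map (T.Zm j) = D.ensembleLaw N
  law_Zf : ∀ j, P.map (T.Zf j) = D.ensembleLaw N
  indep_Zm : ∀ j, Indep (MeasurableSpace.comap (T.Zm j) inferInstance) (T.past D j) P
  indep_Zf : ∀ j, Indep (MeasurableSpace.comap (T.Zf j) inferInstance) (T.pastHalf D j) P

/-- The event `U_j` that the model is `(κ_ef, κ_eg)`-first-order accurate. -/
def U (κef κeg : ℝ) (j : ℕ) : Set Ω :=
  {ω | ‖T.g D j ω - gradient D.f (T.X j ω)‖ ≤ κeg / T.u j ω ∧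
    |D.f (T.X j ω) - T.M D j ω 0| ≤ κef / T.u j ω ^ 2}

/-- The event `V_j` that the function estimates are `ε_f`-accurate. -/
def V (εf : ℝ) (j : ℕ) : Set Ω :=
  {ω | |T.F0 D j ω - D.f (T.X j ω)| ≤ εf / T.u j ω ^ 2 ∧
    |T.F1 D j ω - D.f (T.X j ω + T.S j ω)| ≤ εf / T.u j ω ^ 2}

/-- `p*_j = P(U_j | ℱ_{j-1})`. -/
def pStar [MeasurableSpace Ω] (P : Measure Ω) (κef κeg : ℝ) (j : ℕ) : Ω → ℝ :=
  P⟦T.U D κef κeg j | T.past D j⟧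

/-- `q*_j = P(V_j | ℱ_{j-1/2})`. -/
def qStar [MeasurableSpace Ω] (P : Measure Ω) (εf : ℝ) (j : ℕ) : Ω → ℝ :=
  P⟦T.V D εf j | T.pastHalf D j⟧

end Trajectory

end EnsembleLM

end

/-! Given the past, the iterate, the parameter and (for the estimates) the step are frozen while the
fresh ensemble keeps its law (`condExp_indicator_of_indep`, `Trajectory.IsRun.measurable_past`). So
`p*_j` and `q*_j` are probabilities under `ensembleLaw` at fixed points. The observation terms
cancel in every comparison with `f` and its gradient, so an inaccuracy is a deviation of `(B^N)⁻¹`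
from `(B^∞)⁻¹`, tested on `X_j - z_b` or `X_j + S_j - z_b`.

These deviations are controlled by Chebyshev's inequality around the mean. Since `E (B^N)⁻¹ =
(N-1)/(N-1-n) (B^∞)⁻¹`, the mean is off by the factor `n/(N-1-n)`; the thresholds are the tolerances
at `u_j = c_j` (doubled for values) minus this bias. The lower bound on `N` makes them positive,
`u_j ≤ c_j` makes them admissible, and a union bound combines the two failures. For the gradient,
the expected squared deviation from the mean is the trace of a covariance, at most `n λ_max`.

The main work is the mean. Whitening reduces it to `E (ZᵀZ)⁻¹` for a standard Gaussian `N × n`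
matrix. With `A = (ZᵀZ + δ)⁻¹` everything is bounded, and Gaussian integration by parts in each
entry of `Z` gives an exact identity with leading factor `N - n - 1` (`integral_wishartAux`). Its
trace bounds `E tr A` uniformly in `δ`. Fatou's lemma then yields almost sure invertibility of `ZᵀZ`
and integrability of its inverse, and dominated convergence lets `δ → 0` in the identity
(`integral_gram_inv`). -/

namespace EnsembleLM

/-! ### Algebra and uniform bounds for the regularized inverse -/

section RegularizedInverse

variable {ι κ : Type*} [Fintype ι] [DecidableEq ι] [Fintype κ]

/-- The regularized inverse Gram matrix `(ZᵀZ + δ)⁻¹`. -/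
noncomputable def regInv (δ : ℝ) (Z : Matrix κ ι ℝ) : Matrix ι ι ℝ :=
  (Zᵀ * Z + δ • (1 : Matrix ι ι ℝ))⁻¹

/-- The matrix `(ZᵀZ + δ)⁻¹ Zᵀ`. -/
noncomputable def regPinv (δ : ℝ) (Z : Matrix κ ι ℝ) : Matrix ι κ ℝ :=
  regInv δ Z * Zᵀ

lemma posDef_gram_add {δ : ℝ} (hδ : 0 < δ) (Z : Matrix κ ι ℝ) :
    (Zᵀ * Z + δ • (1 : Matrix ι ι ℝ)).PosDef := by
  have h1 : (Zᵀ * Z).PosSemidef := by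
    simpa using Matrix.posSemidef_conjTranspose_mul_self Z
  exact Matrix.PosDef.posSemidef_add h1 (Matrix.PosDef.one.smul hδ)

lemma isUnit_gram_add {δ : ℝ} (hδ : 0 < δ) (Z : Matrix κ ι ℝ) :
    IsUnit (Zᵀ * Z + δ • (1 : Matrix ι ι ℝ)) := (posDef_gram_add hδ Z).isUnit

lemma regInv_transpose (δ : ℝ) (Z : Matrix κ ι ℝ) : (regInv δ Z)ᵀ = regInv δ Z := by
  simp [regInv, Matrix.transpose_nonsing_inv]

lemma regInv_mul_gram {δ : ℝ} (hδ : 0 < δ) (Z : Matrix κ ι ℝ) :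
    regInv δ Z * (Zᵀ * Z) = 1 - δ • regInv δ Z := by
  have h := Matrix.nonsing_inv_mul _ ((Matrix.isUnit_iff_isUnit_det _).1 (isUnit_gram_add hδ Z))
  rw [eq_sub_iff_add_eq, ← h, Matrix.mul_add]
  simp [regInv]

/-- Expand `A = A (ZᵀZ + δ) A` with `A` symmetric. Diagonal entries of `A` thereby become sums of
squares, the source of all bounds below that are uniform in `Z`. -/
lemma regInv_eq {δ : ℝ} (hδ : 0 < δ) (Z : Matrix κ ι ℝ) :
    regInv δ Z = regPinv δ Z * (regPinv δ Z)ᵀ + δ • (regInv δ Z * (regInv δ Z)ᵀ) := by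
  have h := regInv_mul_gram hδ Z
  rw [regPinv, Matrix.transpose_mul, Matrix.transpose_transpose, regInv_transpose,
    Matrix.mul_assoc, ← Matrix.mul_assoc Zᵀ, ← Matrix.mul_assoc, h, sub_mul]
  simp

lemma regInv_apply {δ : ℝ} (hδ : 0 < δ) (Z : Matrix κ ι ℝ) (i l : ι) :
    regInv δ Z i l = ∑ k, regPinv δ Z i k * regPinv δ Z l k
      + δ * ∑ m, regInv δ Z i m * regInv δ Z l m := by
  conv_lhs => rw [regInv_eq hδ Z]
  simp [Matrix.mul_apply]

lemma regInv_diag_nonneg {δ : ℝ} (hδ : 0 < δ) (Z : Matrix κ ι ℝ) (i : ι) :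
    0 ≤ regInv δ Z i i := by
  rw [regInv_apply hδ]
  exact add_nonneg (Finset.sum_nonneg fun _ _ => mul_self_nonneg _)
    (mul_nonneg hδ.le (Finset.sum_nonneg fun _ _ => mul_self_nonneg _))

lemma regInv_mul_self_le {δ : ℝ} (hδ : 0 < δ) (Z : Matrix κ ι ℝ) (i l : ι) :
    δ * (regInv δ Z i l * regInv δ Z i l) ≤ regInv δ Z i i := by
  conv_rhs => rw [regInv_apply hδ]
  have h1 : 0 ≤ ∑ k, regPinv δ Z i k * regPinv δ Z i k :=
    Finset.sum_nonneg fun _ _ => mul_self_nonneg _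
  have h2 : regInv δ Z i l * regInv δ Z i l ≤ ∑ m, regInv δ Z i m * regInv δ Z i m :=
    Finset.single_le_sum (f := fun m => regInv δ Z i m * regInv δ Z i m)
      (fun _ _ => mul_self_nonneg _) (Finset.mem_univ l)
  nlinarith

lemma regPinv_mul_self_le {δ : ℝ} (hδ : 0 < δ) (Z : Matrix κ ι ℝ) (i : ι) (k : κ) :
    regPinv δ Z i k * regPinv δ Z i k ≤ regInv δ Z i i := by
  conv_rhs => rw [regInv_apply hδ]
  have h1 : 0 ≤ ∑ m, regInv δ Z i m * regInv δ Z i m :=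
    Finset.sum_nonneg fun _ _ => mul_self_nonneg _
  have h2 : regPinv δ Z i k * regPinv δ Z i k ≤ ∑ m, regPinv δ Z i m * regPinv δ Z i m :=
    Finset.single_le_sum (f := fun m => regPinv δ Z i m * regPinv δ Z i m)
      (fun _ _ => mul_self_nonneg _) (Finset.mem_univ k)
  nlinarith

lemma regInv_diag_le {δ : ℝ} (hδ : 0 < δ) (Z : Matrix κ ι ℝ) (i : ι) :
    regInv δ Z i i ≤ δ⁻¹ := by
  have h := regInv_mul_self_le hδ Z i i
  have h0 := regInv_diag_nonneg hδ Z i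
  rw [← one_div, le_div_iff₀ hδ]
  rcases h0.eq_or_lt with h1 | h1
  · rw [← h1]; simp
  · by_contra! h2
    nlinarith

lemma abs_delta_mul_regInv_le {δ : ℝ} (hδ : 0 < δ) (Z : Matrix κ ι ℝ) (i l : ι) :
    |δ * regInv δ Z i l| ≤ 1 := by
  apply abs_le_one_iff_mul_self_le_one.2
  have h := regInv_mul_self_le hδ Z i l
  have h1 : δ * regInv δ Z i i ≤ 1 := by
    have := mul_le_mul_of_nonneg_left (regInv_diag_le hδ Z i) hδ.le
    rwa [mul_inv_cancel₀ hδ.ne'] at this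
  nlinarith

lemma abs_regInv_le {δ : ℝ} (hδ : 0 < δ) (Z : Matrix κ ι ℝ) (i l : ι) :
    |regInv δ Z i l| ≤ δ⁻¹ := by
  have h := abs_delta_mul_regInv_le hδ Z i l
  rw [abs_mul, abs_of_pos hδ] at h
  rwa [← one_div, le_div_iff₀ hδ, mul_comm]

lemma abs_regPinv_le {δ : ℝ} (hδ : 0 < δ) (Z : Matrix κ ι ℝ) (i : ι) (k : κ) :
    |regPinv δ Z i k| ≤ 1 + δ⁻¹ := by
  have h := (regPinv_mul_self_le hδ Z i k).trans (regInv_diag_le hδ Z i)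
  have h0 : 0 < δ⁻¹ := inv_pos.2 hδ
  apply abs_le_of_sq_le_sq' _ (by positivity) |> abs_le.2
  nlinarith

/-- The hat matrix `Z (ZᵀZ + δ)⁻¹ Zᵀ` satisfies `H = H Hᵀ + δ (ZA)(ZA)ᵀ`. -/
lemma hat_diag_mem {δ : ℝ} (hδ : 0 < δ) (Z : Matrix κ ι ℝ) (k : κ) :
    (Z * regPinv δ Z) k k ∈ Set.Icc (0 : ℝ) 1 := by
  have h : Z * regPinv δ Z = (Z * regPinv δ Z) * (Z * regPinv δ Z)ᵀ
      + δ • ((Z * regInv δ Z) * (Z * regInv δ Z)ᵀ) := by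
    have h1 : Z * regPinv δ Z = Z * regInv δ Z * Zᵀ := by rw [regPinv, Matrix.mul_assoc]
    conv_lhs => rw [h1, regInv_eq hδ Z]
    simp [Matrix.mul_add, Matrix.add_mul, Matrix.mul_assoc, Matrix.transpose_mul]
  set H := Z * regPinv δ Z
  have h2 : H k k = H k ⬝ᵥ (fun j => Hᵀ j k)
      + δ * ((Z * regInv δ Z) k ⬝ᵥ (fun j => (Z * regInv δ Z)ᵀ j k)) :=
    congrFun (congrFun h k) k
  have h3 : H k k * H k k ≤ H k ⬝ᵥ (fun j => Hᵀ j k) := by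
    simp only [dotProduct, Matrix.transpose_apply]
    exact Finset.single_le_sum (f := fun m => H k m * H k m)
      (fun _ _ => mul_self_nonneg _) (Finset.mem_univ k)
  have h4 : 0 ≤ (Z * regInv δ Z) k ⬝ᵥ (fun j => (Z * regInv δ Z)ᵀ j k) := by
    simp only [dotProduct, Matrix.transpose_apply]
    exact Finset.sum_nonneg fun _ _ => mul_self_nonneg _
  have h5 := mul_nonneg hδ.le h4
  -- A number with `h² ≤ h` lies in `[0, 1]`.
  have h6 : H k k * H k k ≤ H k k := by linarith
  constructor
  · nlinarith [mul_self_nonneg (H k k)]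
  · by_contra! h7
    nlinarith

/-- The partial derivative of the `(i, k)` entry of `regPinv` with respect to `Z k l`. -/
noncomputable def regPinvDeriv (δ : ℝ) (k : κ) (i l : ι) (Z : Matrix κ ι ℝ) : ℝ :=
  regInv δ Z i l * (1 - (Z * regPinv δ Z) k k) - regPinv δ Z i k * regPinv δ Z l k

lemma abs_regPinvDeriv_le {δ : ℝ} (hδ : 0 < δ) (k : κ) (i l : ι) (Z : Matrix κ ι ℝ) :
    |regPinvDeriv δ k i l Z| ≤ δ⁻¹ + (1 + δ⁻¹) * (1 + δ⁻¹) := by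
  have h := hat_diag_mem hδ Z k
  refine (abs_sub _ _).trans (add_le_add ?_ ?_)
  · rw [abs_mul]
    have : |1 - (Z * regPinv δ Z) k k| ≤ 1 := by
      rw [abs_le]; constructor <;> linarith [h.1, h.2]
    exact (mul_le_mul (abs_regInv_le hδ Z i l) this (abs_nonneg _) (inv_pos.2 hδ).le).trans
      (mul_one _).le
  · rw [abs_mul]
    have h0 : 0 < δ⁻¹ := inv_pos.2 hδ
    exact mul_le_mul (abs_regPinv_le hδ Z i k) (abs_regPinv_le hδ Z l k) (abs_nonneg _)
      (by positivity)

lemma sum_regPinv_mul {δ : ℝ} (hδ : 0 < δ) (Z : Matrix κ ι ℝ) (i l : ι) :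
    ∑ k, regPinv δ Z i k * Z k l = (1 : Matrix ι ι ℝ) i l - δ * regInv δ Z i l := by
  have h := congrFun (congrFun (regInv_mul_gram hδ Z) i) l
  rw [← Matrix.mul_assoc, Matrix.mul_apply] at h
  simpa [regPinv] using h

/-- The hat matrix has trace `n - δ tr A`, and `∑ₖ Pᵢₖ Pₗₖ` is `Aᵢₗ` up to a term of order `δ`. The
two together lower the number of rows by `n + 1`, which is where the denominator `N - 1 - n` comes
from. -/
lemma sum_regPinvDeriv {δ : ℝ} (hδ : 0 < δ) (Z : Matrix κ ι ℝ) (i l : ι) :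
    ∑ k, regPinvDeriv δ k i l Z =
      regInv δ Z i l * (Fintype.card κ - Fintype.card ι - 1 + δ * (regInv δ Z).trace)
        + δ * ∑ m, regInv δ Z i m * regInv δ Z l m := by
  have h1 : ∑ k, (Z * regPinv δ Z) k k = Fintype.card ι - δ * (regInv δ Z).trace := by
    have : ∑ k, (Z * regPinv δ Z) k k = (regInv δ Z * (Zᵀ * Z)).trace := by
      rw [← Matrix.mul_assoc, Matrix.trace_mul_comm]; rfl
    rw [this, regInv_mul_gram hδ Z]; simp
  have h2 := regInv_apply hδ Z i l
  simp only [regPinvDeriv, Finset.sum_sub_distrib, ← Finset.mul_sum, h1]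
  simp only [Finset.sum_const, Finset.card_univ, nsmul_eq_mul, mul_one]
  linarith

end RegularizedInverse

/-! ### Differentiating the regularized inverse in one matrix entry -/

section RegularizedInverseDeriv

variable {ι κ : Type*} [Fintype ι] [DecidableEq ι] [Fintype κ]

attribute [local instance] Matrix.linftyOpNormedRing Matrix.linftyOpNormedAlgebra

lemma hasDerivAt_regInv {δ : ℝ} (hδ : 0 < δ) (Z E : Matrix κ ι ℝ) (i l : ι) :
    HasDerivAt (fun t : ℝ => regInv δ (Z + t • E) i l)
      (-(regInv δ Z * (Eᵀ * Z + Zᵀ * E) * regInv δ Z) i l) 0 := by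
  -- The regularized Gram matrix along `Z + tE` is exactly quadratic in `t`; the derivative then
  -- follows from that of inversion, `-A w' A`.
  let w : ℝ → Matrix ι ι ℝ := fun t =>
    (Zᵀ * Z + δ • (1 : Matrix ι ι ℝ)) + (t • (Eᵀ * Z + Zᵀ * E) + (t * t) • (Eᵀ * E))
  have hw : ∀ t : ℝ, (Z + t • E)ᵀ * (Z + t • E) + δ • (1 : Matrix ι ι ℝ) = w t := by
    intro t
    simp only [w, Matrix.transpose_add, Matrix.transpose_smul, Matrix.add_mul, Matrix.mul_add,
      Matrix.smul_mul, Matrix.mul_smul, smul_add, smul_smul]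
    abel
  have hd : HasDerivAt w (Eᵀ * Z + Zᵀ * E) 0 := by
    have h1 : HasDerivAt (fun t : ℝ => t • (Eᵀ * Z + Zᵀ * E)) ((1 : ℝ) • (Eᵀ * Z + Zᵀ * E)) 0 :=
      (hasDerivAt_id (0 : ℝ)).smul_const _
    have h2 : HasDerivAt (fun t : ℝ => (t * t) • (Eᵀ * E))
        (((1 : ℝ) * 0 + 0 * 1) • (Eᵀ * E)) 0 :=
      ((hasDerivAt_id (0 : ℝ)).mul (hasDerivAt_id (0 : ℝ))).smul_const _
    exact ((h1.add h2).const_add (Zᵀ * Z + δ • (1 : Matrix ι ι ℝ))).congr_deriv (by simp)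
  have hw0 : w 0 = Zᵀ * Z + δ • (1 : Matrix ι ι ℝ) := by simp [w]
  obtain ⟨x, hx⟩ := isUnit_gram_add hδ Z
  have hinv : (↑x⁻¹ : Matrix ι ι ℝ) = regInv δ Z := by
    rw [regInv, ← hx, Matrix.coe_units_inv]
  have h3 := hasFDerivAt_ringInverse (𝕜 := ℝ) x
  rw [hx, ← hw0] at h3
  have h4 := h3.comp_hasDerivAt (0 : ℝ) hd
  let e : Matrix ι ι ℝ →L[ℝ] ℝ := LinearMap.toContinuousLinearMap
    (Matrix.entryLinearMap ℝ ℝ i l)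
  have h5 := e.hasFDerivAt.comp_hasDerivAt (0 : ℝ) h4
  have h6 : (fun t : ℝ => regInv δ (Z + t • E) i l) = e ∘ (Ring.inverse ∘ w) := by
    ext t
    rw [regInv, hw, Matrix.nonsing_inv_eq_ringInverse]
    simp [e]
  rw [h6]
  refine h5.congr_deriv ?_
  simp only [neg_apply, ContinuousLinearMap.mulLeftRight_apply, hinv]
  rfl

/-- Product rule on `∑ₘ Aᵢₘ Zₖₘ`. As `E` is a matrix unit, the terms from differentiating `A`
collapse: with `H` the hat matrix, `(A Eᵀ H)ᵢₖ = Aᵢₗ Hₖₖ` and `(P E P)ᵢₖ = Pᵢₖ Pₗₖ`. -/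
lemma hasDerivAt_regPinv [DecidableEq κ] {δ : ℝ} (hδ : 0 < δ) (Z : Matrix κ ι ℝ) (k : κ) (i l : ι) :
    HasDerivAt (fun t : ℝ => regPinv δ (Z + t • Matrix.single k l (1 : ℝ)) i k)
      (regPinvDeriv δ k i l Z) 0 := by
  set E : Matrix κ ι ℝ := Matrix.single k l (1 : ℝ) with hE
  have h1 : (fun t : ℝ => regPinv δ (Z + t • E) i k)
      = fun t : ℝ => ∑ m, regInv δ (Z + t • E) i m * (Z k m + t * E k m) := by
    ext t
    simp [regPinv, Matrix.mul_apply]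
  rw [h1]
  have h2 : ∀ m, HasDerivAt (fun t : ℝ => regInv δ (Z + t • E) i m * (Z k m + t * E k m))
      (-(regInv δ Z * (Eᵀ * Z + Zᵀ * E) * regInv δ Z) i m * (Z k m + 0 * E k m)
        + regInv δ (Z + (0 : ℝ) • E) i m * (1 * E k m)) 0 := fun m =>
    (hasDerivAt_regInv hδ Z E i m).mul
      (((hasDerivAt_id (0 : ℝ)).mul_const (E k m)).const_add (Z k m))
  refine (HasDerivAt.fun_sum (u := Finset.univ) fun m _ => h2 m).congr_deriv ?_
  have h3 : ∑ m, regInv δ Z i m * E k m = regInv δ Z i l := by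
    simp [hE, Matrix.single_apply]
  have h4 : ∑ m, (regInv δ Z * (Eᵀ * Z + Zᵀ * E) * regInv δ Z) i m * Z k m
      = regInv δ Z i l * (Z * regPinv δ Z) k k + regPinv δ Z i k * regPinv δ Z l k := by
    have h5 : ∑ m, (regInv δ Z * (Eᵀ * Z + Zᵀ * E) * regInv δ Z) i m * Z k m
        = (regInv δ Z * (Eᵀ * Z + Zᵀ * E) * regInv δ Z * Zᵀ) i k := by
      simp [Matrix.mul_apply]
    have h6 : regInv δ Z * (Eᵀ * Z + Zᵀ * E) * regInv δ Z * Zᵀ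
        = regInv δ Z * Eᵀ * (Z * regPinv δ Z) + regPinv δ Z * E * regPinv δ Z := by
      simp only [regPinv, Matrix.mul_add, Matrix.add_mul, Matrix.mul_assoc]
    rw [h5, h6, Matrix.add_apply]
    congr 1
    · rw [Matrix.mul_apply]
      simp [hE, Matrix.mul_apply, Matrix.single_apply, ite_and]
    · rw [Matrix.mul_apply]
      simp [hE, Matrix.mul_apply, Matrix.single_apply, ite_and]
  simp only [zero_mul, add_zero, one_mul, zero_smul, neg_mul, Finset.sum_add_distrib,
    Finset.sum_neg_distrib, h3, h4, regPinvDeriv]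
  ring

/-- Taking as base point the matrix whose entry is already `t` moves the derivative at zero to every
`t`, in the form required by integration by parts under resampling of an entry. -/
lemma hasDerivAt_regPinv_update [DecidableEq κ] {δ : ℝ} (hδ : 0 < δ) (Z : κ → ι → ℝ) (k : κ) (i l : ι) (t : ℝ) :
    HasDerivAt (fun s : ℝ => regPinv δ
        (Matrix.of (Function.update Z k (Function.update (Z k) l s))) i k)
      (regPinvDeriv δ k i l
        (Matrix.of (Function.update Z k (Function.update (Z k) l t)))) t := by
  set Z' := Matrix.of (Function.update Z k (Function.update (Z k) l t)) with hZ'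
  have h1 : ∀ s : ℝ, Matrix.of (Function.update Z k (Function.update (Z k) l s))
      = Z' + (s - t) • Matrix.single k l (1 : ℝ) := by
    intro s
    ext a b
    by_cases ha : a = k
    · subst ha
      by_cases hb : b = l
      · subst hb; simp [hZ']
      · simp [hZ', Function.update_of_ne hb, Ne.symm hb]
    · simp [hZ', Function.update_of_ne ha, Ne.symm ha]
  simp_rw [h1]
  have h2 := hasDerivAt_regPinv hδ Z' k i l
  have h3 : HasDerivAt (fun s : ℝ => s - t) 1 t := (hasDerivAt_id t).sub_const t
  exact (HasDerivAt.comp_of_eq t h2 h3 (sub_self t).symm).congr_deriv (mul_one _)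

end RegularizedInverseDeriv

/-! ### Gaussian integration by parts -/

section Stein

/-- The standard Gaussian density satisfies `v' = -x v`; integrate by parts on the line, boundedness
of `f` and `f'` giving integrability. -/
lemma integral_mul_id_gaussianReal {f f' : ℝ → ℝ} {C : ℝ} (hf : ∀ x, HasDerivAt f (f' x) x)
    (hb : ∀ x, |f x| ≤ C) (hb' : ∀ x, |f' x| ≤ C) (hm : Measurable f') :
    ∫ x, f x * x ∂(gaussianReal 0 1) = ∫ x, f' x ∂(gaussianReal 0 1) := by
  have hfc : Continuous f := continuous_iff_continuousAt.2 fun x => (hf x).continuousAt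
  have hv : ∀ x, HasDerivAt (gaussianPDFReal 0 1) (-(x * gaussianPDFReal 0 1 x)) x := by
    intro x
    have h : HasDerivAt (fun x : ℝ => -(x - 0) ^ 2 / (2 * ((1 : NNReal) : ℝ))) (-x) x := by
      have := (((hasDerivAt_id x).sub_const 0).pow 2).neg.div_const (2 * ((1 : NNReal) : ℝ))
      refine this.congr_deriv ?_
      simp only [NNReal.coe_one, id]
      push_cast
      ring
    have h2 := (h.exp).const_mul (√(2 * Real.pi * ((1 : NNReal) : ℝ)))⁻¹
    refine h2.congr_deriv ?_
    simp only [gaussianPDFReal]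
    ring
  have hg : Integrable (gaussianPDFReal 0 1) := integrable_gaussianPDFReal 0 1
  have hid : Integrable (fun x : ℝ => x * gaussianPDFReal 0 1 x) := by
    have h1 : Integrable (fun x : ℝ => x) (gaussianReal 0 1) :=
      (memLp_id_gaussianReal 1).integrable le_rfl
    rw [gaussianReal_of_var_ne_zero _ one_ne_zero, integrable_withDensity_iff
      (measurable_gaussianPDF 0 1) (by simp [gaussianPDF])] at h1
    simpa [toReal_gaussianPDF] using h1
  have i1 : Integrable (fun x => f x * (-(x * gaussianPDFReal 0 1 x))) :=
    hid.neg.bdd_mul hfc.aestronglyMeasurable (Filter.Eventually.of_forall hb)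
  have i2 : Integrable (fun x => f' x * gaussianPDFReal 0 1 x) :=
    hg.bdd_mul hm.aestronglyMeasurable (Filter.Eventually.of_forall hb')
  have i3 : Integrable (fun x => f x * gaussianPDFReal 0 1 x) :=
    hg.bdd_mul hfc.aestronglyMeasurable (Filter.Eventually.of_forall hb)
  have key := integral_mul_deriv_eq_deriv_mul_of_integrable (fun x _ => hf x) (fun x _ => hv x)
    i1 i2 i3
  rw [integral_gaussianReal_eq_integral_smul one_ne_zero,
    integral_gaussianReal_eq_integral_smul one_ne_zero]
  simp only [smul_eq_mul]
  have e1 : ∀ x, gaussianPDFReal 0 1 x * (f x * x) = -(f x * -(x * gaussianPDFReal 0 1 x)) := by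
    intro x; ring
  simp_rw [e1, integral_neg, key, neg_neg, mul_comm (gaussianPDFReal 0 1 _)]

/-- Resampling one coordinate preserves a product measure. -/
lemma measurePreserving_update {ι : Type*} [Fintype ι] [DecidableEq ι] {α : ι → Type*}
    [∀ i, MeasurableSpace (α i)] (μ : ∀ i, Measure (α i)) [∀ i, IsProbabilityMeasure (μ i)]
    (i : ι) :
    MeasurePreserving (fun p : (∀ j, α j) × α i => Function.update p.1 i p.2)
      ((Measure.pi μ).prod (μ i)) (Measure.pi μ) := by
  have hm : Measurable (fun p : (∀ j, α j) × α i => Function.update p.1 i p.2) := by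
    refine measurable_pi_lambda _ fun j => ?_
    by_cases h : j = i
    · subst h; simpa using measurable_snd
    · simp only [Function.update_of_ne h]
      exact (measurable_pi_apply j).comp measurable_fst
  refine ⟨hm, Eq.symm <| Measure.pi_eq fun s hs => ?_⟩
  rw [Measure.map_apply hm (MeasurableSet.univ_pi hs)]
  have h1 : (fun p : (∀ j, α j) × α i => Function.update p.1 i p.2) ⁻¹' Set.univ.pi s
      = (Set.univ.pi (Function.update s i Set.univ)) ×ˢ s i := by
    ext p
    simp only [Set.mem_preimage, Set.mem_pi, Set.mem_univ, true_implies, Set.mem_prod]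
    constructor
    · intro h
      refine ⟨fun j => ?_, by simpa using h i⟩
      by_cases hj : j = i
      · subst hj; simp
      · simpa [Function.update_of_ne hj] using h j
    · rintro ⟨h, h'⟩ j
      by_cases hj : j = i
      · subst hj; simpa using h'
      · simpa [Function.update_of_ne hj] using h j
  rw [h1, Measure.prod_prod, Measure.pi_pi, ← Finset.prod_erase_mul _ _ (Finset.mem_univ i),
    ← Finset.prod_erase_mul (a := i) _ (fun j => μ j (s j)) (Finset.mem_univ i)]
  simp only [Function.update_self, measure_univ, mul_one]
  congr 1
  refine Finset.prod_congr rfl fun j hj => ?_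
  rw [Function.update_of_ne (Finset.ne_of_mem_erase hj)]

/-- Because resampling a coordinate preserves the law, that coordinate can be integrated alone,
without splitting the product space. Used first for a row, then for an entry of it. -/
lemma integral_pi_eq_integral_update {ι : Type*} [Fintype ι] [DecidableEq ι] {α : ι → Type*}
    [∀ i, MeasurableSpace (α i)] (μ : ∀ i, Measure (α i)) [∀ i, IsProbabilityMeasure (μ i)]
    (i : ι) {F : (∀ j, α j) → ℝ} (hF : Integrable F (Measure.pi μ)) :
    ∫ x, F x ∂(Measure.pi μ) = ∫ x, ∫ t, F (Function.update x i t) ∂(μ i) ∂(Measure.pi μ) := by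
  have h := measurePreserving_update μ i
  rw [← integral_prod (fun p : (∀ j, α j) × α i => F (Function.update p.1 i p.2))
    (h.integrable_comp_of_integrable hF)]
  conv_lhs => rw [← h.map_eq]
  exact integral_map h.measurable.aemeasurable (h.map_eq.symm ▸ hF.aestronglyMeasurable)

lemma integrable_eval_gaussian {ι : Type*} [Fintype ι] (l : ι) :
    Integrable (fun z : ι → ℝ => z l) (Measure.pi fun _ : ι => gaussianReal 0 1) :=
  (measurePreserving_eval (fun _ : ι => gaussianReal 0 1) l).integrable_comp_of_integrable
    ((memLp_id_gaussianReal 1).integrable le_rfl)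

lemma integral_mul_eval_gaussian {ι : Type*} [Fintype ι] [DecidableEq ι] (l : ι)
    {f f' : (ι → ℝ) → ℝ} {C : ℝ}
    (hf : ∀ z t, HasDerivAt (fun s => f (Function.update z l s)) (f' (Function.update z l t)) t)
    (hb : ∀ z, |f z| ≤ C) (hb' : ∀ z, |f' z| ≤ C) (hm : Measurable f) (hm' : Measurable f') :
    ∫ z, f z * z l ∂(Measure.pi fun _ : ι => gaussianReal 0 1)
      = ∫ z, f' z ∂(Measure.pi fun _ : ι => gaussianReal 0 1) := by
  rw [integral_pi_eq_integral_update _ l (F := fun z => f z * z l)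
      ((integrable_eval_gaussian l).bdd_mul hm.aestronglyMeasurable
        (Filter.Eventually.of_forall hb)),
    integral_pi_eq_integral_update _ l (F := f')
      (Integrable.of_bound hm'.aestronglyMeasurable C (Filter.Eventually.of_forall hb'))]
  congr 1
  ext z
  simp only [Function.update_self]
  exact integral_mul_id_gaussianReal (fun t => hf z t) (fun _ => hb _) (fun _ => hb' _)
    (hm'.comp (measurable_update z))

/-- The law of a matrix with independent standard Gaussian entries. -/
noncomputable def gaussMat (κ ι : Type*) [Fintype κ] [Fintype ι] : Measure (κ → ι → ℝ) :=
  Measure.pi fun _ : κ => Measure.pi fun _ : ι => gaussianReal 0 1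

instance (κ ι : Type*) [Fintype κ] [Fintype ι] : IsProbabilityMeasure (gaussMat κ ι) := by
  unfold gaussMat; infer_instance

variable {ι κ : Type*} [Fintype ι] [Fintype κ]

lemma integrable_entry_gaussMat (k : κ) (l : ι) :
    Integrable (fun Z : κ → ι → ℝ => Z k l) (gaussMat κ ι) :=
  (measurePreserving_eval (fun _ : κ => Measure.pi fun _ : ι => gaussianReal 0 1)
    k).integrable_comp_of_integrable (integrable_eval_gaussian l)

/-- Gaussian integration by parts in one entry of a standard Gaussian matrix. -/
lemma integral_mul_entry_gaussMat [DecidableEq ι] [DecidableEq κ] (k : κ) (l : ι)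
    {F F' : (κ → ι → ℝ) → ℝ} {C : ℝ}
    (hF : ∀ Z t, HasDerivAt (fun s => F (Function.update Z k (Function.update (Z k) l s)))
      (F' (Function.update Z k (Function.update (Z k) l t))) t)
    (hb : ∀ Z, |F Z| ≤ C) (hb' : ∀ Z, |F' Z| ≤ C) (hm : Measurable F) (hm' : Measurable F') :
    ∫ Z, F Z * Z k l ∂(gaussMat κ ι) = ∫ Z, F' Z ∂(gaussMat κ ι) := by
  unfold gaussMat
  rw [integral_pi_eq_integral_update _ k (F := fun Z => F Z * Z k l)
      ((integrable_entry_gaussMat k l).bdd_mul hm.aestronglyMeasurable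
        (Filter.Eventually.of_forall hb)),
    integral_pi_eq_integral_update _ k (F := F')
      (Integrable.of_bound hm'.aestronglyMeasurable C (Filter.Eventually.of_forall hb'))]
  congr 1
  ext Z
  simp only [Function.update_self]
  refine integral_mul_eval_gaussian l (fun z t => ?_) (fun _ => hb _) (fun _ => hb' _)
    (hm.comp (measurable_update Z)) (hm'.comp (measurable_update Z))
  simpa using hF (Function.update Z k z) t

end Stein

/-! ### Measurability of matrix inverses -/

section MatrixMeasurability

variable {ι κ α : Type*} [Fintype ι] [DecidableEq ι] [Fintype κ] [MeasurableSpace α]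

lemma measurable_det {B : α → Matrix ι ι ℝ} (h : ∀ i l, Measurable fun a => B a i l) :
    Measurable fun a => (B a).det := by
  simp only [Matrix.det_apply]
  exact Finset.measurable_fun_sum _ fun σ _ =>
    (Finset.measurable_fun_prod _ fun i _ => h _ _).const_smul _

/-- The inverse is the adjugate times the reciprocal determinant. The convention that the reciprocal
of zero is zero covers singular matrices. -/
lemma measurable_inv_entry {B : α → Matrix ι ι ℝ} (h : ∀ i l, Measurable fun a => B a i l)
    (i l : ι) : Measurable fun a => (B a)⁻¹ i l := by
  simp only [Matrix.inv_def, Matrix.smul_apply, Ring.inverse_eq_inv', smul_eq_mul,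
    Matrix.adjugate_apply]
  refine (measurable_det h).inv.mul (measurable_det fun i' l' => ?_)
  by_cases hi : i' = l
  · subst hi; simp
  · simpa [Matrix.updateRow_ne hi] using h i' l'

lemma measurable_regInv (δ : ℝ) (i l : ι) :
    Measurable fun Z : κ → ι → ℝ => regInv δ (Matrix.of Z) i l := by
  refine measurable_inv_entry (fun i l => ?_) i l
  simp only [Matrix.add_apply, Matrix.mul_apply, Matrix.transpose_apply, Matrix.of_apply]
  fun_prop

lemma measurable_regPinv (δ : ℝ) (i : ι) (k : κ) :
    Measurable fun Z : κ → ι → ℝ => regPinv δ (Matrix.of Z) i k := by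
  simp only [regPinv, Matrix.mul_apply, Matrix.transpose_apply, Matrix.of_apply]
  have := fun m => measurable_regInv (κ := κ) δ i m
  fun_prop

lemma measurable_regPinvDeriv (δ : ℝ) (k : κ) (i l : ι) :
    Measurable fun Z : κ → ι → ℝ => regPinvDeriv δ k i l (Matrix.of Z) := by
  simp only [regPinvDeriv, Matrix.mul_apply, Matrix.of_apply]
  have h1 := fun i m => measurable_regInv (ι := ι) (κ := κ) δ i m
  have h2 := fun i m => measurable_regPinv (ι := ι) (κ := κ) δ i m
  fun_prop

end MatrixMeasurability

/-! ### The integration-by-parts identity and bounds uniform in the regularization -/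

section InverseWishart

variable {ι κ : Type*} [Fintype ι] [DecidableEq ι] [Fintype κ]

/-- The integrand whose mean the Gaussian integration by parts computes. -/
noncomputable def wishartAux (δ : ℝ) (i l : ι) (Z : Matrix κ ι ℝ) : ℝ :=
  regInv δ Z i l * (Fintype.card κ - Fintype.card ι - 1 + δ * (regInv δ Z).trace)
        + δ * ∑ m, regInv δ Z i m * regInv δ Z l m + δ * regInv δ Z i l

lemma integrable_regInv {δ : ℝ} (hδ : 0 < δ) (i l : ι) :
    Integrable (fun Z : κ → ι → ℝ => regInv δ (Matrix.of Z) i l) (gaussMat κ ι) :=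
  Integrable.of_bound (measurable_regInv δ i l).aestronglyMeasurable δ⁻¹
    (Filter.Eventually.of_forall fun _ => abs_regInv_le hδ _ i l)

/-- Sum integration by parts over the rows `k`: the products `∑ₖ Pᵢₖ Zₖₗ` equal `1 - δA`, and the
derivatives sum to the leading terms of `wishartAux`. The identity is exact for each `δ > 0`, with
no condition on the dimensions. -/
lemma integral_wishartAux {δ : ℝ} (hδ : 0 < δ) (i l : ι) :
    ∫ Z : κ → ι → ℝ, wishartAux δ i l (Matrix.of Z) ∂(gaussMat κ ι) = (1 : Matrix ι ι ℝ) i l := by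
  classical
  have hδ' : 0 < δ⁻¹ := inv_pos.2 hδ
  set C := δ⁻¹ + (1 + δ⁻¹) * (1 + δ⁻¹) with hC
  have hbP : ∀ k (Z : κ → ι → ℝ), |regPinv δ (Matrix.of Z) i k| ≤ C := fun k Z =>
    (abs_regPinv_le hδ _ i k).trans (by nlinarith)
  have hstein : ∀ k, ∫ Z : κ → ι → ℝ, regPinv δ (Matrix.of Z) i k * Z k l ∂(gaussMat κ ι)
      = ∫ Z : κ → ι → ℝ, regPinvDeriv δ k i l (Matrix.of Z) ∂(gaussMat κ ι) := fun k =>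
    integral_mul_entry_gaussMat k l (fun Z t => hasDerivAt_regPinv_update hδ Z k i l t)
      (hbP k) (fun Z => abs_regPinvDeriv_le hδ k i l _) (measurable_regPinv δ i k)
      (measurable_regPinvDeriv δ k i l)
  have hi1 : ∀ k, Integrable (fun Z : κ → ι → ℝ => regPinv δ (Matrix.of Z) i k * Z k l)
      (gaussMat κ ι) := fun k =>
    (integrable_entry_gaussMat k l).bdd_mul (measurable_regPinv δ i k).aestronglyMeasurable
      (Filter.Eventually.of_forall (hbP k))
  have hi2 : ∀ k, Integrable (fun Z : κ → ι → ℝ => regPinvDeriv δ k i l (Matrix.of Z))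
      (gaussMat κ ι) := fun k =>
    Integrable.of_bound (measurable_regPinvDeriv δ k i l).aestronglyMeasurable C
      (Filter.Eventually.of_forall fun Z => abs_regPinvDeriv_le hδ k i l _)
  have hsum := Finset.sum_congr (s₁ := Finset.univ) rfl fun k _ => hstein k
  rw [← integral_finsetSum _ fun k _ => hi1 k, ← integral_finsetSum _ fun k _ => hi2 k] at hsum
  have e1 : ∀ Z : κ → ι → ℝ, ∑ k, regPinv δ (Matrix.of Z) i k * Z k l
      = (1 : Matrix ι ι ℝ) i l - δ * regInv δ (Matrix.of Z) i l := fun Z =>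
    sum_regPinv_mul hδ (Matrix.of Z) i l
  have e2 : ∀ Z : κ → ι → ℝ, wishartAux δ i l (Matrix.of Z)
      = ∑ k, regPinvDeriv δ k i l (Matrix.of Z) + δ * regInv δ (Matrix.of Z) i l := fun Z => by
    rw [sum_regPinvDeriv hδ]; rfl
  simp_rw [e1] at hsum
  simp_rw [e2]
  rw [integral_add (integrable_finsetSum _ fun k _ => hi2 k)
    ((integrable_regInv hδ i l).const_mul δ), ← hsum,
    integral_sub (integrable_const _) ((integrable_regInv hδ i l).const_mul δ)]
  simp

lemma abs_sum_mul_le {τ : Type*} [Fintype τ] (a b : τ → ℝ) :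
    |∑ k, a k * b k| ≤ (∑ k, a k * a k + ∑ k, b k * b k) / 2 := by
  refine (Finset.abs_sum_le_sum_abs _ _).trans ?_
  rw [← Finset.sum_add_distrib, Finset.sum_div]
  refine Finset.sum_le_sum fun k _ => abs_le.2 ⟨?_, ?_⟩
  · nlinarith [mul_self_nonneg (a k + b k)]
  · nlinarith [mul_self_nonneg (a k - b k)]

lemma abs_regInv_le_trace {δ : ℝ} (hδ : 0 < δ) (Z : Matrix κ ι ℝ) (i l : ι) :
    |regInv δ Z i l| ≤ (regInv δ Z).trace := by
  have h1 : |regInv δ Z i l| ≤ (regInv δ Z i i + regInv δ Z l l) / 2 := by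
    have a1 := abs_sum_mul_le (regPinv δ Z i) (regPinv δ Z l)
    have a2 := mul_le_mul_of_nonneg_left (abs_sum_mul_le (regInv δ Z i) (regInv δ Z l)) hδ.le
    rw [regInv_apply hδ Z i l, regInv_apply hδ Z i i, regInv_apply hδ Z l l]
    refine (abs_add_le _ _).trans ?_
    rw [abs_mul, abs_of_pos hδ]
    linarith
  have h2 : ∀ m, regInv δ Z m m ≤ (regInv δ Z).trace := fun m =>
    Finset.single_le_sum (f := fun m => regInv δ Z m m)
      (fun m _ => regInv_diag_nonneg hδ Z m) (Finset.mem_univ m)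
  linarith [h2 i, h2 l]

lemma regInv_trace_nonneg {δ : ℝ} (hδ : 0 < δ) (Z : Matrix κ ι ℝ) :
    0 ≤ (regInv δ Z).trace := Finset.sum_nonneg fun m _ => regInv_diag_nonneg hδ Z m

lemma integrable_regInv_trace {δ : ℝ} (hδ : 0 < δ) :
    Integrable (fun Z : κ → ι → ℝ => (regInv δ (Matrix.of Z)).trace) (gaussMat κ ι) :=
  integrable_finsetSum _ fun i _ => integrable_regInv hδ i i

/-- Take the trace of the exact identity and discard the nonnegative terms carrying a factor `δ`.
The resulting bound does not depend on `δ`. -/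
lemma integral_regInv_trace_le {δ : ℝ} (hδ : 0 < δ) :
    (Fintype.card κ - Fintype.card ι - 1 : ℝ) *
      ∫ Z : κ → ι → ℝ, (regInv δ (Matrix.of Z)).trace ∂(gaussMat κ ι) ≤ Fintype.card ι := by
  have hwi : ∀ i : ι, Integrable (fun Z : κ → ι → ℝ => wishartAux δ i i (Matrix.of Z))
      (gaussMat κ ι) := by
    intro i
    have hA := fun i l => measurable_regInv (κ := κ) (ι := ι) δ i l
    have ht : ∀ m Z, |regInv δ (Matrix.of (Z : κ → ι → ℝ)) i m| ≤ δ⁻¹ :=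
      fun m Z => abs_regInv_le hδ _ _ _
    have i1 := (integrable_regInv_trace (κ := κ) (ι := ι) hδ).const_mul δ
    have i2 := ((integrable_const (Fintype.card κ - Fintype.card ι - 1 : ℝ)).add i1).bdd_mul
      (hA i i).aestronglyMeasurable (Filter.Eventually.of_forall (ht i))
    have i3 : Integrable (fun Z : κ → ι → ℝ => δ * ∑ m, regInv δ (Matrix.of Z) i m *
        regInv δ (Matrix.of Z) i m) (gaussMat κ ι) :=
      (integrable_finsetSum _ fun m _ => (integrable_regInv hδ i m).bdd_mul
        (hA i m).aestronglyMeasurable (Filter.Eventually.of_forall (ht m))).const_mul δ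
    exact (i2.add i3).add ((integrable_regInv hδ i i).const_mul δ)
  have h1 : ∀ Z : κ → ι → ℝ, (Fintype.card κ - Fintype.card ι - 1 : ℝ)
      * (regInv δ (Matrix.of Z)).trace ≤ ∑ i, wishartAux δ i i (Matrix.of Z) := by
    intro Z
    simp only [wishartAux, Finset.sum_add_distrib, ← Finset.sum_mul, ← Finset.mul_sum]
    have e : ∑ i, regInv δ (Matrix.of Z) i i = (regInv δ (Matrix.of Z)).trace := rfl
    rw [e]
    have t0 := regInv_trace_nonneg hδ (Matrix.of Z)
    have s0 : 0 ≤ ∑ i, ∑ m, regInv δ (Matrix.of Z) i m * regInv δ (Matrix.of Z) i m :=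
      Finset.sum_nonneg fun _ _ => Finset.sum_nonneg fun _ _ => mul_self_nonneg _
    nlinarith [mul_nonneg hδ.le s0, mul_nonneg hδ.le t0, mul_nonneg hδ.le (mul_nonneg t0 t0)]
  calc (Fintype.card κ - Fintype.card ι - 1 : ℝ) *
        ∫ Z : κ → ι → ℝ, (regInv δ (Matrix.of Z)).trace ∂(gaussMat κ ι)
      = ∫ Z : κ → ι → ℝ, (Fintype.card κ - Fintype.card ι - 1 : ℝ)
        * (regInv δ (Matrix.of Z)).trace ∂(gaussMat κ ι) := (integral_const_mul _ _).symm
    _ ≤ ∫ Z : κ → ι → ℝ, ∑ i, wishartAux δ i i (Matrix.of Z) ∂(gaussMat κ ι) :=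
        integral_mono ((integrable_regInv_trace hδ).const_mul _)
          (integrable_finsetSum _ fun i _ => hwi i) h1
    _ = Fintype.card ι := by
        rw [integral_finsetSum _ fun i _ => hwi i]
        simp [integral_wishartAux hδ]

/-- A kernel vector `v` of the Gram matrix satisfies `δ A v = v`, so the Frobenius norm of `δA` is
at least one; and `δ` times the squared Frobenius norm of `A` is at most its trace. Singularity thus
makes the trace blow up as `δ → 0`. -/
lemma inv_le_regInv_trace {δ : ℝ} (hδ : 0 < δ) (Z : Matrix κ ι ℝ) (h : (Zᵀ * Z).det = 0) :
    δ⁻¹ ≤ (regInv δ Z).trace := by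
  obtain ⟨v, hv0, hv⟩ := Matrix.exists_mulVec_eq_zero_iff.2 h
  have h1 : ∀ i, v i = δ * ∑ l, regInv δ Z i l * v l := by
    intro i
    have e := congrFun (congrArg (fun M => M *ᵥ v) (regInv_mul_gram hδ Z)) i
    simp only [← Matrix.mulVec_mulVec, hv, Matrix.mulVec_zero, Matrix.sub_mulVec,
      Matrix.one_mulVec, Matrix.smul_mulVec, Pi.sub_apply, Pi.smul_apply, smul_eq_mul,
      Pi.zero_apply] at e
    have : (regInv δ Z *ᵥ v) i = ∑ l, regInv δ Z i l * v l := rfl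
    rw [← this]; linarith
  have hV : 0 < ∑ l, v l ^ 2 := by
    obtain ⟨a, ha⟩ := Function.ne_iff.1 hv0
    exact Finset.sum_pos' (fun _ _ => sq_nonneg _) ⟨a, Finset.mem_univ _, by
      have : v a ≠ 0 := ha
      positivity⟩
  have h2 : ∑ i, v i ^ 2 ≤ δ ^ 2 * ((∑ i, ∑ l, regInv δ Z i l ^ 2) * ∑ l, v l ^ 2) := by
    rw [Finset.sum_mul, Finset.mul_sum]
    refine Finset.sum_le_sum fun i _ => ?_
    rw [h1 i, mul_pow]
    exact mul_le_mul_of_nonneg_left (Finset.sum_mul_sq_le_sq_mul_sq _ _ _) (sq_nonneg _)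
  have h3 : 1 ≤ δ ^ 2 * ∑ i, ∑ l, regInv δ Z i l ^ 2 := by
    by_contra! h4
    nlinarith
  have h5 : δ * ∑ i, ∑ l, regInv δ Z i l ^ 2 ≤ (regInv δ Z).trace := by
    rw [Finset.mul_sum]
    refine Finset.sum_le_sum fun i _ => ?_
    rw [Matrix.diag_apply, regInv_apply hδ]
    simp only [← pow_two]
    exact le_add_of_nonneg_left (Finset.sum_nonneg fun _ _ => sq_nonneg _)
  rw [inv_le_iff_one_le_mul₀ hδ]
  nlinarith

lemma tendsto_regInv {Z : Matrix κ ι ℝ} (h : (Zᵀ * Z).det ≠ 0) (i l : ι) {δ : ℕ → ℝ}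
    (hδ : Filter.Tendsto δ Filter.atTop (nhds 0)) :
    Filter.Tendsto (fun m => regInv (δ m) Z i l) Filter.atTop (nhds ((Zᵀ * Z)⁻¹ i l)) := by
  have hc : Continuous fun d : ℝ => Zᵀ * Z + d • (1 : Matrix ι ι ℝ) := by fun_prop
  have h0 : (fun d : ℝ => Zᵀ * Z + d • (1 : Matrix ι ι ℝ)) 0 = Zᵀ * Z := by simp
  have h1 : ContinuousAt (fun d : ℝ => regInv d Z i l) 0 := by
    simp only [regInv, Matrix.inv_def, Matrix.smul_apply, Ring.inverse_eq_inv', smul_eq_mul]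
    refine ContinuousAt.mul (ContinuousAt.inv₀ hc.matrix_det.continuousAt ?_) ?_
    · simpa using h
    · exact (hc.matrix_adjugate.matrix_elem i l).continuousAt
  have h2 := h1.tendsto.comp hδ
  simpa [regInv, Function.comp_def] using h2

/-- With `W = ZᵀZ`, iterating `W⁻¹ = A + δ A W⁻¹` gives `W⁻¹ = A + δ A Aᵀ + δ² A W⁻¹ Aᵀ`, and the
last two terms are positive semidefinite. -/
lemma regInv_trace_le {δ : ℝ} (hδ : 0 < δ) {Z : Matrix κ ι ℝ} (h : (Zᵀ * Z).det ≠ 0) :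
    (regInv δ Z).trace ≤ ((Zᵀ * Z)⁻¹).trace := by
  set W := Zᵀ * Z with hW
  have hWu : IsUnit W.det := isUnit_iff_ne_zero.2 h
  have hps : (W⁻¹).PosSemidef := by
    have h1 : (Zᵀ * Z).PosSemidef := by simpa using Matrix.posSemidef_conjTranspose_mul_self Z
    exact h1.inv
  set A := regInv δ Z
  have hA : A * W = 1 - δ • A := regInv_mul_gram hδ Z
  have hAt : Aᵀ = A := regInv_transpose δ Z
  have e1 : W⁻¹ = A + δ • (A * W⁻¹) := by
    calc W⁻¹ = (A * W + δ • A) * W⁻¹ := by rw [hA]; simp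
      _ = A + δ • (A * W⁻¹) := by
        rw [add_mul, Matrix.mul_assoc, Matrix.mul_nonsing_inv _ hWu]; simp
  have hWt : (W⁻¹)ᵀ = W⁻¹ := by
    rw [Matrix.transpose_nonsing_inv, hW, Matrix.transpose_mul, Matrix.transpose_transpose]
  have e1' : W⁻¹ = A + δ • (W⁻¹ * A) := by
    have := congrArg Matrix.transpose e1
    rwa [Matrix.transpose_add, Matrix.transpose_smul, Matrix.transpose_mul, hAt, hWt] at this
  have e2 : W⁻¹ = A + δ • (A * Aᵀ) + (δ * δ) • (A * W⁻¹ * Aᵀ) := by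
    rw [hAt]
    conv_lhs => rw [e1]
    conv_lhs => rw [e1']
    rw [Matrix.mul_add, Matrix.mul_smul, smul_add, smul_smul, Matrix.mul_assoc, add_assoc]
  have t1 : 0 ≤ (A * Aᵀ).trace := by
    have : (A * Aᵀ).PosSemidef := by simpa using Matrix.posSemidef_self_mul_conjTranspose A
    exact this.trace_nonneg
  have t2 : 0 ≤ (A * W⁻¹ * Aᵀ).trace := by
    have := hps.mul_mul_conjTranspose_same A
    rw [Matrix.conjTranspose_eq_transpose_of_trivial] at this
    exact this.trace_nonneg
  rw [e2]
  simp only [Matrix.trace_add, Matrix.trace_smul, smul_eq_mul]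
  nlinarith [mul_nonneg hδ.le t1, mul_nonneg (mul_nonneg hδ.le hδ.le) t2]

end InverseWishart

/-! ### Removing the regularization: the mean of the inverse Gram matrix -/

section InverseWishartMean

variable {ι κ : Type*} [Fintype ι] [DecidableEq ι] [Fintype κ]

open Filter Topology

/-- Fatou's lemma with the uniform trace bound, along `δ = 1/(m+1)`. It serves twice: for
invertibility and for integrability. -/
lemma lintegral_liminf_regInv_trace_lt_top (hcard : Fintype.card ι + 1 < Fintype.card κ) :
    ∫⁻ Z : κ → ι → ℝ, liminf (fun m : ℕ =>
        ENNReal.ofReal (regInv (1 / ((m : ℝ) + 1)) (Matrix.of Z)).trace) atTop ∂(gaussMat κ ι)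
      < ∞ := by
  have hc : (0 : ℝ) < Fintype.card κ - Fintype.card ι - 1 := by
    have : ((Fintype.card ι + 1 : ℕ) : ℝ) < Fintype.card κ := by exact_mod_cast hcard
    push_cast at this; linarith
  have hδ : ∀ m : ℕ, (0 : ℝ) < 1 / ((m : ℝ) + 1) := fun m => by positivity
  refine (lintegral_liminf_le fun m => ?_).trans_lt ?_
  · exact ENNReal.measurable_ofReal.comp
      (Finset.measurable_fun_sum _ fun i _ => measurable_regInv _ i i)
  · refine lt_of_le_of_lt (b := ENNReal.ofReal (Fintype.card ι /
      (Fintype.card κ - Fintype.card ι - 1 : ℝ))) ?_ ENNReal.ofReal_lt_top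
    refine liminf_le_of_frequently_le' (Frequently.of_forall fun m => ?_)
    rw [← ofReal_integral_eq_lintegral_ofReal (integrable_regInv_trace (hδ m))
      (Eventually.of_forall fun Z => regInv_trace_nonneg (hδ m) _)]
    refine ENNReal.ofReal_le_ofReal ?_
    rw [le_div_iff₀ hc, mul_comm]
    exact integral_regInv_trace_le (hδ m)

/-- A Wishart matrix with enough degrees of freedom is almost surely invertible. -/
lemma ae_det_gram_ne_zero (hcard : Fintype.card ι + 1 < Fintype.card κ) :
    ∀ᵐ Z : κ → ι → ℝ ∂(gaussMat κ ι), ((Matrix.of Z)ᵀ * Matrix.of Z).det ≠ 0 := by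
  have hmeas : Measurable fun Z : κ → ι → ℝ => liminf (fun m : ℕ =>
        ENNReal.ofReal (regInv (1 / ((m : ℝ) + 1)) (Matrix.of Z)).trace) atTop :=
    Measurable.liminf fun m => ENNReal.measurable_ofReal.comp
      (Finset.measurable_fun_sum _ fun i _ => measurable_regInv _ i i)
  filter_upwards [ae_lt_top hmeas (lintegral_liminf_regInv_trace_lt_top hcard).ne] with Z hZ hdet
  -- For a singular Gram matrix the trace at `δ = 1/(m+1)` is at least `m + 1`, so the lower limit
  -- would be infinite.
  refine hZ.ne (Tendsto.liminf_eq ?_)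
  refine tendsto_of_tendsto_of_tendsto_of_le_of_le (ENNReal.tendsto_nat_nhds_top)
    tendsto_const_nhds (fun m => ?_) fun m => le_top
  have h := inv_le_regInv_trace (δ := 1 / ((m : ℝ) + 1)) (by positivity) _ hdet
  rw [one_div, inv_inv] at h
  simp only [one_div]
  rw [← ENNReal.ofReal_natCast]
  exact ENNReal.ofReal_le_ofReal (by linarith)

lemma measurable_gram_inv (i l : ι) :
    Measurable fun Z : κ → ι → ℝ => ((Matrix.of Z)ᵀ * Matrix.of Z)⁻¹ i l := by
  simpa [regInv] using measurable_regInv (κ := κ) (ι := ι) 0 i l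

lemma integrable_gram_inv_trace (hcard : Fintype.card ι + 1 < Fintype.card κ) :
    Integrable (fun Z : κ → ι → ℝ => (((Matrix.of Z)ᵀ * Matrix.of Z)⁻¹).trace)
      (gaussMat κ ι) := by
  refine ⟨(Finset.measurable_fun_sum _ fun i _ => measurable_gram_inv i i).aestronglyMeasurable,
    ?_⟩
  refine lt_of_le_of_lt (lintegral_mono_ae ?_) (lintegral_liminf_regInv_trace_lt_top (ι := ι) (κ := κ) hcard)
  filter_upwards [ae_det_gram_ne_zero hcard] with Z hZ
  have h1 : Tendsto (fun m : ℕ => (regInv (1 / ((m : ℝ) + 1)) (Matrix.of Z)).trace) atTop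
      (𝓝 (((Matrix.of Z)ᵀ * Matrix.of Z)⁻¹).trace) :=
    tendsto_finsetSum _ fun i _ => tendsto_regInv hZ i i tendsto_one_div_add_atTop_nhds_zero_nat
  have h0 : 0 ≤ (((Matrix.of Z)ᵀ * Matrix.of Z)⁻¹).trace :=
    ge_of_tendsto' h1 fun m => regInv_trace_nonneg (by positivity) _
  rw [Real.enorm_eq_ofReal h0]
  exact ((ENNReal.continuous_ofReal.tendsto _).comp h1).liminf_eq.ge

lemma tendsto_wishartAux {Z : Matrix κ ι ℝ} (h : (Zᵀ * Z).det ≠ 0) (i l : ι) :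
    Tendsto (fun m : ℕ => wishartAux (1 / ((m : ℝ) + 1)) i l Z) atTop
      (𝓝 ((Zᵀ * Z)⁻¹ i l * (Fintype.card κ - Fintype.card ι - 1))) := by
  have hδ := tendsto_one_div_add_atTop_nhds_zero_nat (𝕜 := ℝ)
  have hA := fun i l => tendsto_regInv h i l hδ
  have htr : Tendsto (fun m : ℕ => (regInv (1 / ((m : ℝ) + 1)) Z).trace) atTop
      (𝓝 ((Zᵀ * Z)⁻¹).trace) := tendsto_finsetSum _ fun i _ => hA i i
  have h1 := (hA i l).mul ((hδ.mul htr).const_add (Fintype.card κ - Fintype.card ι - 1 : ℝ))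
  have h2 := hδ.mul (tendsto_finsetSum Finset.univ fun m _ => (hA i m).mul (hA l m))
  have h3 := hδ.mul (hA i l)
  simpa [wishartAux] using (h1.add h2).add h3

/-- Every factor `δ` is absorbed by `|δ Aᵢₗ| ≤ 1` or `δ ≤ 1`, leaving one entry of `A`, which is at
most the trace of the inverse Gram matrix. This is the integrable majorant for dominated
convergence. -/
lemma abs_wishartAux_le {δ : ℝ} (hδ : 0 < δ) (hδ1 : δ ≤ 1) {Z : Matrix κ ι ℝ}
    (h : (Zᵀ * Z).det ≠ 0) (i l : ι) :
    |wishartAux δ i l Z| ≤ (|(Fintype.card κ - Fintype.card ι - 1 : ℝ)| + 2 + Fintype.card ι) *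
      ((Zᵀ * Z)⁻¹).trace := by
  set τ := ((Zᵀ * Z)⁻¹).trace
  have ht : (regInv δ Z).trace ≤ τ := regInv_trace_le hδ h
  have ht0 := regInv_trace_nonneg hδ Z
  have hA : ∀ i l, |regInv δ Z i l| ≤ τ := fun i l => (abs_regInv_le_trace hδ Z i l).trans ht
  have hδA := abs_delta_mul_regInv_le hδ Z
  set c : ℝ := Fintype.card κ - Fintype.card ι - 1
  have e : wishartAux δ i l Z = regInv δ Z i l * c
      + (δ * regInv δ Z i l) * (regInv δ Z).trace
      + ∑ m, (δ * regInv δ Z i m) * regInv δ Z l m + δ * regInv δ Z i l := by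
    simp only [wishartAux, Finset.mul_sum, mul_assoc, c]
    ring
  have b1 : |regInv δ Z i l * c| ≤ |c| * τ := by
    rw [abs_mul, mul_comm]; exact mul_le_mul_of_nonneg_left (hA i l) (abs_nonneg _)
  have b2 : |(δ * regInv δ Z i l) * (regInv δ Z).trace| ≤ τ := by
    rw [abs_mul, abs_of_nonneg ht0]
    exact (mul_le_of_le_one_left ht0 (hδA i l)).trans ht
  have b3 : |∑ m, (δ * regInv δ Z i m) * regInv δ Z l m| ≤ Fintype.card ι * τ := by
    refine (Finset.abs_sum_le_sum_abs _ _).trans ?_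
    refine (Finset.sum_le_card_nsmul _ _ τ fun m _ => ?_).trans (by simp)
    rw [abs_mul]
    exact (mul_le_of_le_one_left (abs_nonneg _) (hδA i m)).trans (hA l m)
  have b4 : |δ * regInv δ Z i l| ≤ τ := by
    rw [abs_mul, abs_of_pos hδ]
    exact (mul_le_of_le_one_left (abs_nonneg _) hδ1).trans (hA i l)
  rw [e]
  refine (abs_add_le _ _).trans ((add_le_add ((abs_add_le _ _).trans
    (add_le_add ((abs_add_le _ _).trans (add_le_add b1 b2)) b3)) b4).trans (le_of_eq ?_))
  ring

lemma abs_gram_inv_le_trace {Z : Matrix κ ι ℝ} (h : (Zᵀ * Z).det ≠ 0) (i l : ι) :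
    |(Zᵀ * Z)⁻¹ i l| ≤ ((Zᵀ * Z)⁻¹).trace :=
  le_of_tendsto (tendsto_regInv h i l tendsto_one_div_add_atTop_nhds_zero_nat).abs
    (Eventually.of_forall fun m =>
      (abs_regInv_le_trace (by positivity) Z i l).trans (regInv_trace_le (by positivity) h))

lemma integrable_gram_inv (hcard : Fintype.card ι + 1 < Fintype.card κ) (i l : ι) :
    Integrable (fun Z : κ → ι → ℝ => ((Matrix.of Z)ᵀ * Matrix.of Z)⁻¹ i l) (gaussMat κ ι) := by
  refine (integrable_gram_inv_trace hcard).mono' (measurable_gram_inv i l).aestronglyMeasurable ?_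
  filter_upwards [ae_det_gram_ne_zero hcard] with Z hZ
  exact abs_gram_inv_le_trace hZ i l

/-- The mean of a standard inverse Wishart matrix. -/
lemma integral_gram_inv (hcard : Fintype.card ι + 1 < Fintype.card κ) (i l : ι) :
    ∫ Z : κ → ι → ℝ, ((Matrix.of Z)ᵀ * Matrix.of Z)⁻¹ i l ∂(gaussMat κ ι)
      = (Fintype.card κ - Fintype.card ι - 1 : ℝ)⁻¹ * (1 : Matrix ι ι ℝ) i l := by
  have hc : (Fintype.card κ - Fintype.card ι - 1 : ℝ) ≠ 0 := by
    have : ((Fintype.card ι + 1 : ℕ) : ℝ) < Fintype.card κ := by exact_mod_cast hcard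
    push_cast at this
    apply ne_of_gt; linarith
  have hmeas : ∀ δ : ℝ, Measurable fun Z : κ → ι → ℝ => wishartAux δ i l (Matrix.of Z) := by
    intro δ
    have hA := fun i l => measurable_regInv (κ := κ) (ι := ι) δ i l
    simp only [wishartAux, Matrix.trace, Matrix.diag_apply]
    fun_prop
  have h := tendsto_integral_of_dominated_convergence
    (F := fun (m : ℕ) (Z : κ → ι → ℝ) => wishartAux (1 / ((m : ℝ) + 1)) i l (Matrix.of Z))
    (f := fun Z : κ → ι → ℝ => ((Matrix.of Z)ᵀ * Matrix.of Z)⁻¹ i l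
      * (Fintype.card κ - Fintype.card ι - 1)) (μ := gaussMat κ ι)
    (fun Z => (|(Fintype.card κ - Fintype.card ι - 1 : ℝ)| + 2 + Fintype.card ι) *
      (((Matrix.of Z)ᵀ * Matrix.of Z)⁻¹).trace)
    (fun m => (hmeas _).aestronglyMeasurable)
    ((integrable_gram_inv_trace hcard).const_mul _)
    (fun m => by
      filter_upwards [ae_det_gram_ne_zero hcard] with Z hZ
      refine abs_wishartAux_le (by positivity) ?_ hZ i l
      rw [div_le_one (by positivity)]
      have : (0 : ℝ) ≤ m := by positivity
      linarith)
    (by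
      filter_upwards [ae_det_gram_ne_zero hcard] with Z hZ
      exact tendsto_wishartAux hZ i l)
  have h' : ∀ m : ℕ, ∫ Z : κ → ι → ℝ, wishartAux (1 / ((m : ℝ) + 1)) i l (Matrix.of Z)
      ∂(gaussMat κ ι) = (1 : Matrix ι ι ℝ) i l := fun m =>
    integral_wishartAux (by positivity) i l
  simp_rw [h'] at h
  -- The regularized integrals do not depend on `m`, so the integral of the limit equals their
  -- common value.
  have h2 := tendsto_nhds_unique h tendsto_const_nhds
  rw [integral_mul_const] at h2
  rw [← h2]
  field_simp

end InverseWishartMean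

/-! ### Whitening and the mean of the empirical precision matrix -/

section EmpiricalPrecision

open scoped MatrixOrder

variable {n m N : ℕ} (D : Problem n m)

lemma measurable_empCov (zb : EuclideanSpace ℝ (Fin n)) (i l : Fin n) :
    Measurable fun Z : Fin N → EuclideanSpace ℝ (Fin n) => empCov zb Z i l := by
  simp only [empCov, Matrix.smul_apply, Matrix.sum_apply, Matrix.vecMulVec_apply, smul_eq_mul,
    PiLp.sub_apply]
  fun_prop

lemma measurable_empCov_inv (zb : EuclideanSpace ℝ (Fin n)) (i l : Fin n) :
    Measurable fun Z : Fin N → EuclideanSpace ℝ (Fin n) => (empCov zb Z)⁻¹ i l :=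
  measurable_inv_entry (measurable_empCov zb) i l

lemma empCov_transpose (zb : EuclideanSpace ℝ (Fin n)) (Z : Fin N → EuclideanSpace ℝ (Fin n)) :
    (empCov zb Z)ᵀ = empCov zb Z := by
  ext i l
  simp [empCov, Matrix.sum_apply, Matrix.vecMulVec_apply, mul_comm]

namespace Problem

/-- The affine map sending standard Gaussian rows to an ensemble. -/
noncomputable def colour (ζ : Fin N → Fin n → ℝ) : Fin N → EuclideanSpace ℝ (Fin n) := fun k =>
  D.zb + WithLp.toLp 2 (CFC.sqrt D.Binf *ᵥ ζ k)

lemma ensembleLaw_eq_map :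
    D.ensembleLaw N = (gaussMat (Fin N) (Fin n)).map D.colour := by
  have h1 : multivariateGaussian D.zb D.Binf = (Measure.pi fun _ : Fin n => gaussianReal 0 1).map
      (fun z => D.zb + WithLp.toLp 2 (CFC.sqrt D.Binf *ᵥ z)) := by
    rw [multivariateGaussian, ← map_pi_eq_stdGaussian, Measure.map_map (by fun_prop) (by fun_prop)]
    rfl
  unfold ensembleLaw gaussMat
  have hm : Measurable (fun z : Fin n → ℝ => D.zb + WithLp.toLp 2 (CFC.sqrt D.Binf *ᵥ z)) := by
    fun_prop
  have : ∀ _ : Fin N, SigmaFinite ((Measure.pi fun _ : Fin n => gaussianReal 0 1).map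
      (fun z => D.zb + WithLp.toLp 2 (CFC.sqrt D.Binf *ᵥ z))) := fun _ => by
    rw [← h1]; infer_instance
  simp_rw [h1]
  exact (Measure.pi_map_pi (fun _ => hm.aemeasurable)).symm

lemma measurable_colour : Measurable (D.colour (N := N)) := by
  unfold colour
  fun_prop

instance : IsProbabilityMeasure (D.ensembleLaw N) := by
  unfold ensembleLaw; infer_instance

lemma sqrt_transpose : (CFC.sqrt D.Binf)ᵀ = CFC.sqrt D.Binf := by
  have h := (CFC.sqrt_nonneg D.Binf).isSelfAdjoint
  rwa [IsSelfAdjoint, Matrix.star_eq_conjTranspose,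
    Matrix.conjTranspose_eq_transpose_of_trivial] at h

lemma sqrt_mul_sqrt : CFC.sqrt D.Binf * CFC.sqrt D.Binf = D.Binf :=
  CFC.sqrt_mul_sqrt_self _ D.Binf_posDef.posSemidef.nonneg

lemma empCov_colour (ζ : Fin N → Fin n → ℝ) :
    empCov D.zb (D.colour ζ) = ((N : ℝ) - 1)⁻¹ •
      (CFC.sqrt D.Binf * ((Matrix.of ζ)ᵀ * Matrix.of ζ) * CFC.sqrt D.Binf) := by
  rw [empCov]
  congr 1
  have h : CFC.sqrt D.Binf * ((Matrix.of ζ)ᵀ * Matrix.of ζ) * CFC.sqrt D.Binf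
      = (Matrix.of ζ * CFC.sqrt D.Binf)ᵀ * (Matrix.of ζ * CFC.sqrt D.Binf) := by
    rw [Matrix.transpose_mul, D.sqrt_transpose]
    simp only [Matrix.mul_assoc]
  rw [h]
  ext i l
  rw [Matrix.sum_apply, Matrix.mul_apply]
  refine Finset.sum_congr rfl fun k _ => ?_
  have h2 : ∀ i, (D.colour ζ k - D.zb).ofLp i = (Matrix.of ζ * CFC.sqrt D.Binf) k i := by
    intro i
    have h3 : (CFC.sqrt D.Binf *ᵥ ζ k) i = (ζ k ᵥ* CFC.sqrt D.Binf) i := by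
      conv_lhs => rw [← D.sqrt_transpose, Matrix.mulVec_transpose]
    simp only [colour, add_sub_cancel_left, h3]
    rfl
  rw [Matrix.vecMulVec_apply, h2, h2, Matrix.transpose_apply]

/-- Reversing the inverse of a product needs no invertibility with the convention for singular
matrices, so this holds for every sample and not merely almost surely. -/
lemma empCov_colour_inv (hN : (N : ℝ) - 1 ≠ 0) (ζ : Fin N → Fin n → ℝ) :
    (empCov D.zb (D.colour ζ))⁻¹ = ((N : ℝ) - 1) •
      ((CFC.sqrt D.Binf)⁻¹ * ((Matrix.of ζ)ᵀ * Matrix.of ζ)⁻¹ * (CFC.sqrt D.Binf)⁻¹) := by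
  rw [empCov_colour]
  have h1 : ∀ M : Matrix (Fin n) (Fin n) ℝ, (((N : ℝ) - 1)⁻¹ • M)⁻¹ = ((N : ℝ) - 1) • M⁻¹ := by
    intro M
    have e : ((N : ℝ) - 1)⁻¹ • M = (((N : ℝ) - 1)⁻¹ • (1 : Matrix (Fin n) (Fin n) ℝ)) * M := by
      simp
    have e2 : (((N : ℝ) - 1)⁻¹ • (1 : Matrix (Fin n) (Fin n) ℝ))⁻¹
        = ((N : ℝ) - 1) • (1 : Matrix (Fin n) (Fin n) ℝ) := by
      refine Matrix.inv_eq_left_inv ?_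
      rw [Matrix.smul_mul, Matrix.mul_smul, smul_smul, mul_inv_cancel₀ hN]
      simp
    rw [e, Matrix.mul_inv_rev, e2]
    simp
  rw [h1, Matrix.mul_inv_rev, Matrix.mul_inv_rev, Matrix.mul_assoc]

variable {D}

/-- Conjugating `E (ZᵀZ)⁻¹ = (N-n-1)⁻¹ I` by the inverse square root recovers `(B^∞)⁻¹`. Centring at
the known `z_b` keeps `N` degrees of freedom, while the normalization by `N - 1` supplies the
numerator. -/
lemma integrable_empCov_inv_and_integral (hN : n + 1 < N) (i l : Fin n) :
    Integrable (fun Z => (empCov D.zb Z)⁻¹ i l) (D.ensembleLaw N) ∧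
    ∫ Z, (empCov D.zb Z)⁻¹ i l ∂(D.ensembleLaw N)
      = ((N : ℝ) - 1) / ((N : ℝ) - 1 - n) * D.Binf⁻¹ i l := by
  have hN' : (n : ℝ) + 1 < N := by exact_mod_cast hN
  have hn0 : (0 : ℝ) ≤ n := n.cast_nonneg
  have hN1 : (N : ℝ) - 1 ≠ 0 := by apply ne_of_gt; linarith
  have hcard : Fintype.card (Fin n) + 1 < Fintype.card (Fin N) := by simpa using hN
  set L := (CFC.sqrt D.Binf)⁻¹ with hL
  have hentry : ∀ ζ : Fin N → Fin n → ℝ, (empCov D.zb (D.colour ζ))⁻¹ i l = ((N : ℝ) - 1) *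
      ∑ b, (∑ a, L i a * ((Matrix.of ζ)ᵀ * Matrix.of ζ)⁻¹ a b) * L b l := by
    intro ζ
    rw [empCov_colour_inv D hN1]
    simp only [Matrix.smul_apply, Matrix.mul_apply (M := _ * _), smul_eq_mul]
    simp only [Matrix.mul_apply (M := L), ← hL]
  have hint : ∀ a b, Integrable (fun ζ : Fin N → Fin n → ℝ =>
      ((Matrix.of ζ)ᵀ * Matrix.of ζ)⁻¹ a b) (gaussMat (Fin N) (Fin n)) :=
    fun a b => integrable_gram_inv hcard a b
  have hint2 : ∀ b, Integrable (fun ζ : Fin N → Fin n → ℝ =>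
      (∑ a, L i a * ((Matrix.of ζ)ᵀ * Matrix.of ζ)⁻¹ a b) * L b l) (gaussMat (Fin N) (Fin n)) :=
    fun b => (integrable_finsetSum _ fun a _ => (hint a b).const_mul _).mul_const _
  have hms := (measurable_empCov_inv (N := N) D.zb i l)
  rw [ensembleLaw_eq_map, integrable_map_measure hms.aestronglyMeasurable
      (measurable_colour D).aemeasurable, integral_map (measurable_colour D).aemeasurable
      hms.aestronglyMeasurable]
  simp only [Function.comp_def, hentry]
  refine ⟨(integrable_finsetSum _ fun b _ => hint2 b).const_mul _, ?_⟩
  rw [integral_const_mul, integral_finsetSum _ fun b _ => hint2 b]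
  have e1 : ∀ b, ∫ ζ : Fin N → Fin n → ℝ, (∑ a, L i a * ((Matrix.of ζ)ᵀ * Matrix.of ζ)⁻¹ a b) * L b l
      ∂(gaussMat (Fin N) (Fin n)) = ((N : ℝ) - n - 1)⁻¹ * (L i b * L b l) := by
    intro b
    rw [integral_mul_const, integral_finsetSum _ fun a _ => (hint a b).const_mul _]
    simp only [integral_const_mul, integral_gram_inv hcard, Fintype.card_fin, Matrix.one_apply]
    simp
    ring
  have e2 : ∑ b, L i b * L b l = D.Binf⁻¹ i l := by
    have : L * L = D.Binf⁻¹ := by rw [hL, ← Matrix.mul_inv_rev, D.sqrt_mul_sqrt]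
    rw [← this, Matrix.mul_apply]
  simp_rw [e1]
  rw [← Finset.mul_sum, e2]
  have : ((N : ℝ) - n - 1) ≠ 0 := by apply ne_of_gt; linarith
  rw [sub_right_comm]
  field_simp

lemma integral_wsq_empCov_inv (hN : n + 1 < N) (v : EuclideanSpace ℝ (Fin n)) :
    ∫ Z, wsq (empCov D.zb Z)⁻¹ v ∂(D.ensembleLaw N)
      = wsq D.Binf⁻¹ v + (n : ℝ) / ((N : ℝ) - 1 - n) * wsq D.Binf⁻¹ v := by
  have hN' : (n : ℝ) + 1 < N := by exact_mod_cast hN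
  have h0 : ((N : ℝ) - 1 - n) ≠ 0 := by apply ne_of_gt; linarith
  simp only [wsq, dotProduct, Matrix.mulVec]
  have hi : ∀ i l, Integrable (fun Z => (empCov D.zb Z)⁻¹ i l) (D.ensembleLaw N) := fun i l =>
    (integrable_empCov_inv_and_integral hN i l).1
  rw [integral_finsetSum _ fun i _ => (integrable_finsetSum _ fun l _ =>
    (hi i l).mul_const _).const_mul _]
  simp_rw [integral_const_mul]
  simp_rw [fun i => integral_finsetSum (μ := D.ensembleLaw N) Finset.univ
    fun l _ => (hi i l).mul_const (v.ofLp l)]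
  simp_rw [integral_mul_const, fun i l => (integrable_empCov_inv_and_integral (D := D) hN i l).2]
  -- Splits the mean into the exact value and the bias that the thresholds subtract.
  have e : ((N : ℝ) - 1) / ((N : ℝ) - 1 - n) = 1 + (n : ℝ) / ((N : ℝ) - 1 - n) := by
    field_simp; ring
  rw [e, Finset.mul_sum, ← Finset.sum_add_distrib]
  refine Finset.sum_congr rfl fun i _ => ?_
  simp only [mul_assoc, ← Finset.mul_sum]
  ring

lemma integral_mulE_empCov_inv (hN : n + 1 < N) (v : EuclideanSpace ℝ (Fin n)) (i : Fin n) :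
    ∫ Z, mulE (empCov D.zb Z)⁻¹ v i ∂(D.ensembleLaw N)
      = mulE D.Binf⁻¹ v i + (n : ℝ) / ((N : ℝ) - 1 - n) * mulE D.Binf⁻¹ v i := by
  have hN' : (n : ℝ) + 1 < N := by exact_mod_cast hN
  have h0 : ((N : ℝ) - 1 - n) ≠ 0 := by apply ne_of_gt; linarith
  simp only [mulE, dotProduct, Matrix.mulVec]
  have hi : ∀ i l, Integrable (fun Z => (empCov D.zb Z)⁻¹ i l) (D.ensembleLaw N) := fun i l =>
    (integrable_empCov_inv_and_integral hN i l).1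
  rw [integral_finsetSum _ fun l _ => (hi i l).mul_const _]
  simp_rw [integral_mul_const, fun i l => (integrable_empCov_inv_and_integral (D := D) hN i l).2]
  have e : ((N : ℝ) - 1) / ((N : ℝ) - 1 - n) = 1 + (n : ℝ) / ((N : ℝ) - 1 - n) := by
    field_simp; ring
  rw [e]
  simp only [mul_assoc, ← Finset.mul_sum]
  ring

end Problem

end EmpiricalPrecision

/-! ### Chebyshev bounds for values and gradients -/

section Chebyshev

lemma wsq_inv_nonneg {n : ℕ} {B : Matrix (Fin n) (Fin n) ℝ} (hB : B.PosDef)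
    (v : EuclideanSpace ℝ (Fin n)) : 0 ≤ wsq B⁻¹ v := by
  have := hB.inv.posSemidef.dotProduct_mulVec_nonneg v.ofLp
  simpa [wsq] using this

variable {n m N : ℕ} {D : Problem n m}

lemma measurable_wsq_empCov_inv (zb v : EuclideanSpace ℝ (Fin n)) :
    Measurable fun Z : Fin N → EuclideanSpace ℝ (Fin n) => wsq (empCov zb Z)⁻¹ v := by
  have h := measurable_empCov_inv (N := N) zb
  change Measurable fun Z => ∑ i, v.ofLp i * ∑ l, (empCov zb Z)⁻¹ i l * v.ofLp l
  exact Finset.measurable_fun_sum _ fun i _ => (Finset.measurable_fun_sum _ fun l _ =>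
    (h i l).mul_const _).const_mul _

namespace Problem

/-- Chebyshev's inequality for the weighted norm with empirical precision matrix. -/
lemma measure_wsq_deviation_le (hN : n + 1 < N) (x : EuclideanSpace ℝ (Fin n)) {κ u c : ℝ}
    (hκ : 0 < κ) (hu : 0 < u) (huc : u ≤ c) (hΘ : 0 < D.valueThreshold N κ c x) :
    D.ensembleLaw N {Z | κ / u ^ 2 < |(1 / 2) * wsq (empCov D.zb Z)⁻¹ (x - D.zb)
        - (1 / 2) * wsq D.Binf⁻¹ (x - D.zb)|}
      ≤ D.varNormSq N x / ENNReal.ofReal (D.valueThreshold N κ c x ^ 2) := by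
  set Θ := D.valueThreshold N κ c x with hΘdef
  set b := wsq D.Binf⁻¹ (x - D.zb) with hb
  have hN' : (n : ℝ) + 1 < N := by exact_mod_cast hN
  have hr : 0 ≤ (n : ℝ) / ((N : ℝ) - 1 - n) := div_nonneg n.cast_nonneg (by linarith)
  have hb0 : 0 ≤ b := wsq_inv_nonneg D.Binf_posDef _
  have hκc : κ / c ^ 2 ≤ κ / u ^ 2 :=
    div_le_div_of_nonneg_left hκ.le (by positivity) (by gcongr)
  have hcheb := meas_ge_le_evariance_div_sq (μ := D.ensembleLaw N)
    (measurable_wsq_empCov_inv D.zb (x - D.zb)).aestronglyMeasurable (c := Θ.toNNReal)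
    (by simpa using hΘ)
  rw [integral_wsq_empCov_inv hN] at hcheb
  have e : (((Θ.toNNReal : NNReal) : ℝ≥0∞)) ^ 2 = ENNReal.ofReal (Θ ^ 2) := by
    rw [ENNReal.ofReal_pow hΘ.le]; rfl
  rw [e] at hcheb
  refine (measure_mono fun Z hZ => ?_).trans hcheb
  simp only [Set.mem_ofPred_eq] at hZ ⊢
  rw [Real.coe_toNNReal _ hΘ.le]
  set Y := wsq (empCov D.zb Z)⁻¹ (x - D.zb)
  -- Clearing the factor one half doubles the tolerance, and `u ≤ c` replaces `u` by the
  -- deterministic `c`.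
  have h1 : 2 * (κ / c ^ 2) < |Y - b| := by
    rw [← mul_sub, abs_mul, abs_of_pos (by norm_num : (0 : ℝ) < 1 / 2)] at hZ
    linarith
  have h2 : |Y - b| ≤ |Y - (b + n / ((N : ℝ) - 1 - n) * b)| + n / ((N : ℝ) - 1 - n) * b := by
    have := abs_add_le (Y - (b + n / ((N : ℝ) - 1 - n) * b)) (n / ((N : ℝ) - 1 - n) * b)
    rw [abs_of_nonneg (mul_nonneg hr hb0)] at this
    rw [sub_add_eq_sub_sub, sub_add_cancel] at this
    rwa [sub_add_eq_sub_sub]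
  have h3 : Θ = 2 * (κ / c ^ 2) - n / ((N : ℝ) - 1 - n) * b := by
    rw [hΘdef, valueThreshold]; ring
  linarith

lemma covPrec_isHermitian (N : ℕ) (x : EuclideanSpace ℝ (Fin n)) :
    (D.covPrec N x).IsHermitian := by
  ext i k
  simp only [Matrix.conjTranspose_apply, covPrec, Matrix.of_apply, star_trivial]
  exact covariance_comm _ _

lemma trace_le_card_mul_sSup_spectrum {A : Matrix (Fin n) (Fin n) ℝ} (hA : A.IsHermitian) :
    A.trace ≤ n * sSup (spectrum ℝ A) := by
  rw [hA.trace_eq_sum_eigenvalues]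
  have hbdd : BddAbove (spectrum ℝ A) := by
    rw [hA.spectrum_real_eq_range_eigenvalues]; exact (Set.finite_range _).bddAbove
  refine (Finset.sum_le_card_nsmul _ _ (sSup (spectrum ℝ A)) fun i _ => ?_).trans (by simp)
  refine le_csSup hbdd ?_
  rw [hA.spectrum_real_eq_range_eigenvalues]
  exact ⟨i, rfl⟩

/-- Chebyshev's inequality for the empirical precision matrix applied to a vector. -/
lemma measure_mulE_deviation_le (hN : n + 1 < N) (x : EuclideanSpace ℝ (Fin n)) {κ u c : ℝ}
    (hκ : 0 < κ) (hu : 0 < u) (huc : u ≤ c) (hΘ : 0 < D.gradThreshold N κ c x) :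
    D.ensembleLaw N {Z | κ / u < ‖mulE (empCov D.zb Z)⁻¹ (x - D.zb)
        - mulE D.Binf⁻¹ (x - D.zb)‖}
      ≤ n * D.lamMax N x / ENNReal.ofReal (D.gradThreshold N κ c x ^ 2) := by
  set Θ := D.gradThreshold N κ c x with hΘdef
  by_cases hL : ∀ i, MemLp (fun Z : Fin N → EuclideanSpace ℝ (Fin n) =>
      mulE (empCov D.zb Z)⁻¹ (x - D.zb) i) 2 (D.ensembleLaw N)
  swap
  -- In dimension zero the moment condition is vacuous, so its failure forces `n ≠ 0`; hence `n * ∞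
  -- = ∞` and the bound is trivial.
  · have hn : (n : ℝ≥0∞) ≠ 0 := by
      rintro h
      have h' : n = 0 := by exact_mod_cast h
      subst h'
      exact hL fun i => i.elim0
    rw [lamMax, if_neg hL, ENNReal.mul_top hn, ENNReal.top_div_of_ne_top ENNReal.ofReal_ne_top]
    exact le_top
  rw [lamMax, if_pos hL]
  set r := (n : ℝ) / ((N : ℝ) - 1 - n) with hrdef
  have hN' : (n : ℝ) + 1 < N := by exact_mod_cast hN
  have hr : 0 ≤ r := div_nonneg n.cast_nonneg (by linarith)
  set w := mulE D.Binf⁻¹ (x - D.zb) with hw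
  have hκc : κ / c ≤ κ / u := div_le_div_of_nonneg_left hκ.le hu huc
  let V : (Fin N → EuclideanSpace ℝ (Fin n)) → EuclideanSpace ℝ (Fin n) := fun Z =>
    mulE (empCov D.zb Z)⁻¹ (x - D.zb)
  have hV : ∀ i, ∫ Z, V Z i ∂(D.ensembleLaw N) = w i + r * w i := fun i =>
    integral_mulE_empCov_inv hN (x - D.zb) i
  have hsq : ∀ i, Integrable (fun Z => (V Z i - (w i + r * w i)) ^ 2) (D.ensembleLaw N) := fun i =>
    ((hL i).sub (memLp_const _)).integrable_sq
  have hvar : ∀ i, ∫ Z, (V Z i - (w i + r * w i)) ^ 2 ∂(D.ensembleLaw N) = D.covPrec N x i i := by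
    intro i
    rw [covPrec, Matrix.of_apply, covariance_self (hL i).aemeasurable,
      variance_eq_integral (hL i).aemeasurable]
    simp only [← hV, V]
  -- The triangle inequality moves the centre from the exact vector to the mean at cost `r‖w‖`,
  -- exactly what the threshold leaves room for. Markov's inequality is then applied to the squared
  -- distance.
  have hsub : {Z | κ / u < ‖V Z - w‖} ⊆ {Z | ENNReal.ofReal (Θ ^ 2)
      ≤ ENNReal.ofReal (∑ i, (V Z i - (w i + r * w i)) ^ 2)} := by
    intro Z hZ
    simp only [Set.mem_ofPred_eq] at hZ ⊢
    refine ENNReal.ofReal_le_ofReal ?_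
    have h1 : ‖V Z - w‖ ≤ ‖V Z - (w + r • w)‖ + r * ‖w‖ := by
      have := norm_add_le (V Z - (w + r • w)) (r • w)
      rw [norm_smul, Real.norm_of_nonneg hr, sub_add_eq_sub_sub, sub_add_cancel] at this
      rwa [sub_add_eq_sub_sub]
    have h2 : Θ = κ / c - r * ‖w‖ := rfl
    have h3 : Θ ≤ ‖V Z - (w + r • w)‖ := by linarith
    have h4 := pow_le_pow_left₀ hΘ.le h3 2
    rw [EuclideanSpace.real_norm_sq_eq] at h4
    simpa using h4
  have hint : Integrable (fun Z => ∑ i, (V Z i - (w i + r * w i)) ^ 2) (D.ensembleLaw N) :=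
    integrable_finsetSum _ fun i _ => hsq i
  have hpos : ENNReal.ofReal (Θ ^ 2) ≠ 0 := by
    rw [Ne, ENNReal.ofReal_eq_zero, not_le]; positivity
  refine (measure_mono hsub).trans ((meas_ge_le_lintegral_div
    hint.aestronglyMeasurable.aemeasurable.ennreal_ofReal hpos ENNReal.ofReal_ne_top).trans ?_)
  refine ENNReal.div_le_div_right ?_ _
  rw [← ofReal_integral_eq_lintegral_ofReal hint
    (Filter.Eventually.of_forall fun Z => Finset.sum_nonneg fun i _ => sq_nonneg _),
    integral_finsetSum _ fun i _ => hsq i]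
  simp_rw [hvar]
  rw [← ENNReal.ofReal_natCast, ← ENNReal.ofReal_mul n.cast_nonneg]
  exact ENNReal.ofReal_le_ofReal (trace_le_card_mul_sSup_spectrum (covPrec_isHermitian N x))

end Problem

end Chebyshev

/-! ### Gradients of the objective and of the model -/

section Gradients

variable {n m k : ℕ}

lemma mulE_eq (A : Matrix (Fin n) (Fin n) ℝ) (x : EuclideanSpace ℝ (Fin n)) :
    mulE A x = Matrix.toEuclideanCLM (𝕜 := ℝ) A x := rfl

lemma wsq_eq_inner (A : Matrix (Fin n) (Fin n) ℝ) (x : EuclideanSpace ℝ (Fin n)) :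
    wsq A x = inner ℝ x (mulE A x) := by
  simp [wsq, mulE, EuclideanSpace.inner_eq_star_dotProduct, dotProduct_comm]

lemma inner_mulE_comm {A : Matrix (Fin n) (Fin n) ℝ} (hA : Aᵀ = A)
    (x v : EuclideanSpace ℝ (Fin n)) : inner ℝ x (mulE A v) = inner ℝ (mulE A x) v := by
  simp only [mulE, EuclideanSpace.inner_eq_star_dotProduct, star_trivial]
  conv_rhs => rw [← hA, Matrix.mulVec_transpose, dotProduct_comm, ← Matrix.dotProduct_mulVec]
  rw [dotProduct_comm]

lemma hasGradientAt_half_wsq {A : Matrix (Fin k) (Fin k) ℝ} (hA : Aᵀ = A)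
    {r : EuclideanSpace ℝ (Fin n) → EuclideanSpace ℝ (Fin k)}
    {L : EuclideanSpace ℝ (Fin n) →L[ℝ] EuclideanSpace ℝ (Fin k)}
    {x : EuclideanSpace ℝ (Fin n)} (hr : HasFDerivAt r L x) :
    HasGradientAt (fun s => (1 / 2) * wsq A (r s))
      (ContinuousLinearMap.adjoint L (mulE A (r x))) x := by
  rw [hasGradientAt_iff_hasFDerivAt]
  simp only [wsq_eq_inner, mulE_eq]
  have h1 : HasFDerivAt (fun s => Matrix.toEuclideanCLM (𝕜 := ℝ) A (r s))
      ((Matrix.toEuclideanCLM (𝕜 := ℝ) A).comp L) x :=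
    (Matrix.toEuclideanCLM (𝕜 := ℝ) A).hasFDerivAt.comp x hr
  refine ((hr.inner ℝ h1).const_mul (1 / 2 : ℝ)).congr_fderiv ?_
  ext v
  have h2 := inner_mulE_comm hA (r x) (L v)
  simp only [mulE_eq] at h2
  simp [ContinuousLinearMap.adjoint_inner_left, h2, real_inner_comm]
  ring

lemma adjoint_id : ContinuousLinearMap.adjoint
    (ContinuousLinearMap.id ℝ (EuclideanSpace ℝ (Fin n))) = ContinuousLinearMap.id ℝ _ :=
  star_one (EuclideanSpace ℝ (Fin n) →L[ℝ] EuclideanSpace ℝ (Fin n))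

namespace Problem

variable (D : Problem n m)

/-- The contribution of the observation term to the gradient of the cost. -/
noncomputable def obsGrad (x : EuclideanSpace ℝ (Fin n)) : EuclideanSpace ℝ (Fin n) :=
  ContinuousLinearMap.adjoint (-fderiv ℝ D.obs x) (mulE D.R⁻¹ (D.y - D.obs x))

lemma transpose_inv_of_posDef {B : Matrix (Fin k) (Fin k) ℝ} (hB : B.PosDef) : (B⁻¹)ᵀ = B⁻¹ := by
  have h := hB.isHermitian
  rw [Matrix.IsHermitian, Matrix.conjTranspose_eq_transpose_of_trivial] at h
  rw [Matrix.transpose_nonsing_inv, h]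

lemma hasGradientAt_gnModel {B : Matrix (Fin n) (Fin n) ℝ} (hB : Bᵀ = B)
    (x : EuclideanSpace ℝ (Fin n)) :
    HasGradientAt (D.gnModel B x) (mulE B⁻¹ (x - D.zb) + D.obsGrad x) 0 := by
  have hB' : (B⁻¹)ᵀ = B⁻¹ := by rw [Matrix.transpose_nonsing_inv, hB]
  have h1 : HasFDerivAt (fun s : EuclideanSpace ℝ (Fin n) => s + x - D.zb)
      (ContinuousLinearMap.id ℝ _) 0 := ((hasFDerivAt_id _).add_const x).sub_const _
  have h2 : HasFDerivAt (fun s : EuclideanSpace ℝ (Fin n) =>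
      D.y - D.obs x - fderiv ℝ D.obs x s) (-fderiv ℝ D.obs x) 0 :=
    (fderiv ℝ D.obs x).hasFDerivAt.const_sub _
  have h := (hasGradientAt_half_wsq hB' h1).hasFDerivAt.add
    (hasGradientAt_half_wsq (transpose_inv_of_posDef D.R_posDef) h2).hasFDerivAt
  rw [hasGradientAt_iff_hasFDerivAt]
  refine h.congr_fderiv ?_
  simp [obsGrad, adjoint_id]

/-- The Gauss-Newton linearization is exact to first order at the zero step, so its observation part
coincides with that of the gradient of `f` and cancels in the accuracy event. -/
lemma modelGrad_eq {B : Matrix (Fin n) (Fin n) ℝ} (hB : Bᵀ = B) (x : EuclideanSpace ℝ (Fin n)) :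
    D.modelGrad B x = mulE B⁻¹ (x - D.zb) + D.obsGrad x :=
  (D.hasGradientAt_gnModel hB x).gradient

lemma gradient_f_eq (x : EuclideanSpace ℝ (Fin n)) :
    gradient D.f x = mulE D.Binf⁻¹ (x - D.zb) + D.obsGrad x := by
  have h1 : HasFDerivAt (fun s : EuclideanSpace ℝ (Fin n) => s - D.zb)
      (ContinuousLinearMap.id ℝ _) x := (hasFDerivAt_id _).sub_const _
  have h2 : HasFDerivAt (fun s : EuclideanSpace ℝ (Fin n) => D.y - D.obs s)
      (-fderiv ℝ D.obs x) x :=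
    ((D.obs_contDiff.differentiable one_ne_zero) x).hasFDerivAt.const_sub _
  have h := (hasGradientAt_half_wsq (transpose_inv_of_posDef D.Binf_posDef) h1).hasFDerivAt.add
    (hasGradientAt_half_wsq (transpose_inv_of_posDef D.R_posDef) h2).hasFDerivAt
  refine HasGradientAt.gradient ?_
  rw [hasGradientAt_iff_hasFDerivAt]
  refine h.congr_fderiv ?_
  simp [obsGrad, adjoint_id]

/-- The regularization does not change the gradient of the model at the zero step. -/
lemma hasGradientAt_model {B : Matrix (Fin n) (Fin n) ℝ} (hB : Bᵀ = B)
    (x : EuclideanSpace ℝ (Fin n)) (μ : ℝ) :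
    HasGradientAt (D.model B x μ) (D.modelGrad B x) 0 := by
  have h1 := (D.hasGradientAt_gnModel hB x).hasFDerivAt
  rw [← D.modelGrad_eq hB x] at h1
  have h2 : HasFDerivAt (fun s : EuclideanSpace ℝ (Fin n) =>
      (1 / 2) * (μ * ‖D.modelGrad B x‖) * ‖s‖ ^ 2)
      (((1 / 2) * (μ * ‖D.modelGrad B x‖)) • (2 • innerSL ℝ (0 : EuclideanSpace ℝ (Fin n)))) 0 :=
    (hasStrictFDerivAt_norm_sq (0 : EuclideanSpace ℝ (Fin n))).hasFDerivAt.const_mul _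
  rw [hasGradientAt_iff_hasFDerivAt]
  refine (h1.add h2).congr_fderiv ?_
  simp

lemma continuous_obsGrad : Continuous D.obsGrad := by
  have h1 : Continuous fun x => fderiv ℝ D.obs x := D.obs_contDiff.continuous_fderiv one_ne_zero
  have h2 : Continuous D.obs := D.obs_contDiff.continuous
  have h3 : Continuous fun x => ContinuousLinearMap.adjoint (-fderiv ℝ D.obs x) :=
    (LinearIsometryEquiv.continuous _).comp h1.neg
  have h4 : Continuous fun x => mulE D.R⁻¹ (D.y - D.obs x) := by
    simp only [mulE_eq]; fun_prop
  exact h3.clm_apply h4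

end Problem

end Gradients

/-! ### Conditioning on information independent of the ensemble -/

section Freezing

/-- Conditioning on a σ-algebra that is independent of `Z`: the `𝒢`-measurable argument is frozen
and `Z` is averaged out. -/
lemma condExp_indicator_of_indep {Ω E F : Type*} {𝒢 mΩ : MeasurableSpace Ω} [MeasurableSpace E]
    [MeasurableSpace F] {P : Measure Ω} [IsProbabilityMeasure P]
    (h𝒢 : 𝒢 ≤ mΩ) {Z : Ω → E} (hZ : Measurable Z) {Y : Ω → F} (hY : Measurable[𝒢] Y)
    (hind : Indep (MeasurableSpace.comap Z inferInstance) 𝒢 P) {A : Set (E × F)}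
    (hA : MeasurableSet A) :
    P⟦{ω | (Z ω, Y ω) ∈ A} | 𝒢⟧ =ᵐ[P] fun ω => (P.map Z).real {z | (z, Y ω) ∈ A} := by
  have hY' : Measurable Y := hY.mono h𝒢 le_rfl
  have : IsProbabilityMeasure (P.map Z) := Measure.isProbabilityMeasure_map hZ.aemeasurable
  have hVm : MeasurableSet {ω | (Z ω, Y ω) ∈ A} := (hZ.prodMk hY') hA
  have hφ : Measurable fun y => (P.map Z) {z | (z, y) ∈ A} := measurable_measure_prodMk_right hA
  have hφY : Measurable[𝒢] fun ω => (P.map Z) {z | (z, Y ω) ∈ A} := hφ.comp hY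
  have hgm : Measurable[𝒢] fun ω => (P.map Z).real {z | (z, Y ω) ∈ A} := hφY.ennreal_toReal
  refine (ae_eq_condExp_of_forall_setIntegral_eq h𝒢 ((integrable_const 1).indicator hVm)
    (fun s _ _ => ?_) (fun s hs _ => ?_) hgm.stronglyMeasurable.aestronglyMeasurable).symm
  · refine (Integrable.of_bound (hgm.mono h𝒢 le_rfl).aestronglyMeasurable 1
      (Filter.Eventually.of_forall fun ω => ?_)).integrableOn
    rw [Real.norm_of_nonneg measureReal_nonneg]
    exact measureReal_le_one
  · have hs' : MeasurableSet s := h𝒢 s hs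
    -- Membership in the test event `s` is carried as an extra coordinate, so that independence
    -- gives a product law for `Z` and the pair `(Y, 1_s)`, and Tonelli applies.
    let W : Ω → F × Prop := fun ω => (Y ω, ω ∈ s)
    have hW𝒢 : Measurable[𝒢] W := hY.prodMk ((@measurableSet_setOfPred Ω 𝒢 _).1 hs)
    have hW : Measurable W := hW𝒢.mono h𝒢 le_rfl
    have hindW : IndepFun Z W P := by
      rw [IndepFun_iff_Indep]
      exact indep_of_indep_of_le_right hind hW𝒢.comap_le
    have hmap := (indepFun_iff_map_prod_eq_prod_map_map hZ.aemeasurable hW.aemeasurable).1 hindW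
    let A' : Set (E × (F × Prop)) := {p | (p.1, p.2.1) ∈ A ∧ p.2.2}
    have hA' : MeasurableSet A' := by
      refine MeasurableSet.inter ((measurable_fst.prodMk
        (measurable_fst.comp measurable_snd)) hA) ?_
      exact measurableSet_setOfPred.2 (measurable_snd.comp measurable_snd)
    have h1 : P ({ω | (Z ω, Y ω) ∈ A} ∩ s) = ∫⁻ ω in s, (P.map Z) {z | (z, Y ω) ∈ A} ∂P := by
      have e1 : {ω | (Z ω, Y ω) ∈ A} ∩ s = (fun ω => (Z ω, W ω)) ⁻¹' A' := rfl
      rw [e1, ← Measure.map_apply (hZ.prodMk hW) hA', hmap, Measure.prod_apply_symm hA',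
        lintegral_map (measurable_measure_prodMk_right hA') hW, ← lintegral_indicator hs']
      refine lintegral_congr fun ω => ?_
      by_cases hω : ω ∈ s
      · rw [Set.indicator_of_mem hω]
        congr 1
        ext z
        simp [A', W, hω]
      · rw [Set.indicator_of_notMem hω]
        have : (fun z => (z, W ω)) ⁻¹' A' = ∅ := by
          ext z
          simp [A', W, hω]
        rw [this, measure_empty]
    rw [setIntegral_indicator hVm, setIntegral_const, smul_eq_mul, mul_one, Set.inter_comm,
      measureReal_def, h1]
    exact integral_toReal ((hφY.mono h𝒢 le_rfl).aemeasurable)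
      (Filter.Eventually.of_forall fun _ => measure_lt_top _ _)

end Freezing

/-! ### Measurable dependence on ensemble, point and parameter -/

section Measurability

variable {n m N : ℕ} {α : Type*} {mα : MeasurableSpace α}

lemma continuous_mulE (A : Matrix (Fin n) (Fin n) ℝ) : Continuous (mulE A) := by
  have : mulE A = Matrix.toEuclideanCLM (𝕜 := ℝ) A := rfl
  rw [this]; fun_prop

lemma continuous_wsq (A : Matrix (Fin n) (Fin n) ℝ) : Continuous (wsq A) := by
  have : wsq A = fun x => inner ℝ x (mulE A x) := funext (wsq_eq_inner A)
  rw [this]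
  exact continuous_id.inner (continuous_mulE A)

lemma measurable_toLp_of_apply {G : α → EuclideanSpace ℝ (Fin n)}
    (h : ∀ i, Measurable fun a => G a i) : Measurable G := by
  exact (WithLp.measurable_toLp 2 (Fin n → ℝ)).comp (measurable_pi_lambda _ h)

lemma measurable_wsq_empCov_inv_comp (zb : EuclideanSpace ℝ (Fin n))
    {Z : α → Fin N → EuclideanSpace ℝ (Fin n)} {v : α → EuclideanSpace ℝ (Fin n)}
    (hZ : Measurable Z) (hv : Measurable v) :
    Measurable fun a => wsq (empCov zb (Z a))⁻¹ (v a) := by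
  have h := fun i l => (measurable_empCov_inv (N := N) zb i l).comp hZ
  have hv' : ∀ i, Measurable fun a => (v a).ofLp i := fun i => by fun_prop
  change Measurable fun a => ∑ i, (v a).ofLp i * ∑ l, (empCov zb (Z a))⁻¹ i l * (v a).ofLp l
  exact Finset.measurable_fun_sum _ fun i _ => (hv' i).mul (Finset.measurable_fun_sum _ fun l _ =>
    (h i l).mul (hv' l))

lemma measurable_mulE_empCov_inv_comp (zb : EuclideanSpace ℝ (Fin n))
    {Z : α → Fin N → EuclideanSpace ℝ (Fin n)} {v : α → EuclideanSpace ℝ (Fin n)}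
    (hZ : Measurable Z) (hv : Measurable v) :
    Measurable fun a => mulE (empCov zb (Z a))⁻¹ (v a) := by
  have h := fun i l => (measurable_empCov_inv (N := N) zb i l).comp hZ
  have hv' : ∀ i, Measurable fun a => (v a).ofLp i := fun i => by fun_prop
  refine measurable_toLp_of_apply fun i => ?_
  change Measurable fun a => ∑ l, (empCov zb (Z a))⁻¹ i l * (v a).ofLp l
  exact Finset.measurable_fun_sum _ fun l _ => (h i l).mul (hv' l)

/-- A gradient depends measurably on a parameter when the function values do. -/
lemma measurable_of_hasGradientAt {F : α → EuclideanSpace ℝ (Fin n) → ℝ}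
    {G : α → EuclideanSpace ℝ (Fin n)} {x : EuclideanSpace ℝ (Fin n)}
    (hG : ∀ a, HasGradientAt (F a) (G a) x) (hF : ∀ s, Measurable fun a => F a s) :
    Measurable G := by
  refine measurable_toLp_of_apply fun i => ?_
  have hlim : ∀ a, Filter.Tendsto (fun k : ℕ => (k : ℝ) •
      (F a (x + (k : ℝ)⁻¹ • EuclideanSpace.single i (1 : ℝ)) - F a x)) Filter.atTop
      (nhds (G a i)) := by
    intro a
    have h := (hG a).hasFDerivAt.lim (EuclideanSpace.single i (1 : ℝ))
      (c := fun k : ℕ => (k : ℝ)) (l := Filter.atTop)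
      (by simpa using tendsto_natCast_atTop_atTop (R := ℝ))
    simpa [EuclideanSpace.inner_single_right] using h
  exact measurable_of_tendsto_metrizable
    (fun k => ((hF _).sub (hF _)).const_smul (k : ℝ)) (tendsto_pi_nhds.2 hlim)

namespace Problem

variable (D : Problem n m)

lemma continuous_wsq_resid : Continuous fun x => wsq D.R⁻¹ (D.y - D.obs x) :=
  (continuous_wsq _).comp (continuous_const.sub D.obs_contDiff.continuous)

lemma continuous_f : Continuous D.f := by
  unfold f cost
  exact (((continuous_wsq _).comp (continuous_id.sub continuous_const)).const_mul _).add
    ((D.continuous_wsq_resid).const_mul _)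

lemma measurable_cost {Z : α → Fin N → EuclideanSpace ℝ (Fin n)}
    {x : α → EuclideanSpace ℝ (Fin n)} (hZ : Measurable Z) (hx : Measurable x) :
    Measurable fun a => D.cost (empCov D.zb (Z a)) (x a) :=
  ((measurable_wsq_empCov_inv_comp D.zb hZ (hx.sub_const _)).const_mul _).add
    ((D.continuous_wsq_resid.measurable.comp hx).const_mul _)

lemma measurable_modelGrad {Z : α → Fin N → EuclideanSpace ℝ (Fin n)}
    {x : α → EuclideanSpace ℝ (Fin n)} (hZ : Measurable Z) (hx : Measurable x) :
    Measurable fun a => D.modelGrad (empCov D.zb (Z a)) (x a) := by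
  simp_rw [D.modelGrad_eq (empCov_transpose _ _)]
  exact (measurable_mulE_empCov_inv_comp D.zb hZ (hx.sub_const _)).add
    (D.continuous_obsGrad.measurable.comp hx)

lemma measurable_model {Z : α → Fin N → EuclideanSpace ℝ (Fin n)}
    {x : α → EuclideanSpace ℝ (Fin n)} {u : α → ℝ} (hZ : Measurable Z) (hx : Measurable x)
    (hu : Measurable u) (s : EuclideanSpace ℝ (Fin n)) :
    Measurable fun a => D.model (empCov D.zb (Z a)) (x a) (u a) s := by
  have h1 : Continuous fun x => wsq D.R⁻¹ (D.y - D.obs x - fderiv ℝ D.obs x s) :=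
    (continuous_wsq _).comp ((continuous_const.sub D.obs_contDiff.continuous).sub
      ((D.obs_contDiff.continuous_fderiv one_ne_zero).clm_apply continuous_const))
  exact (((measurable_wsq_empCov_inv_comp D.zb hZ ((hx.const_add s).sub_const _)).const_mul _).add
    ((h1.measurable.comp hx).const_mul _)).add
      (((hu.mul (D.measurable_modelGrad hZ hx).norm).const_mul _).mul_const _)

lemma continuous_model (B : Matrix (Fin n) (Fin n) ℝ) (x : EuclideanSpace ℝ (Fin n)) (μ : ℝ) :
    Continuous (D.model B x μ) := by
  have h1 := continuous_wsq B⁻¹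
  have h2 := continuous_wsq D.R⁻¹
  unfold model gnModel
  fun_prop

end Problem

end Measurability

/-! ### Adaptedness of the run and growth of the regularization parameter -/

section Run

variable {Ω : Type*} {mΩ : MeasurableSpace Ω} {P : Measure Ω} {n m N : ℕ} {D : Problem n m}
  {A : Params} {x0 : EuclideanSpace ℝ (Fin n)} {T : Trajectory n N Ω}

namespace Trajectory

variable (T D) in
lemma past_le_succ (j : ℕ) : T.past D j ≤ T.past D (j + 1) :=
  iSup_le fun i => le_iSup (fun i : Fin (j + 1) => MeasurableSpace.comap (T.M D i) inferInstance
    ⊔ (MeasurableSpace.comap (T.F0 D i) inferInstance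
      ⊔ MeasurableSpace.comap (T.F1 D i) inferInstance)) i.castSucc

variable (T D) in
lemma iteration_le_past_succ (j : ℕ) : MeasurableSpace.comap (T.M D j) inferInstance
    ⊔ (MeasurableSpace.comap (T.F0 D j) inferInstance
      ⊔ MeasurableSpace.comap (T.F1 D j) inferInstance) ≤ T.past D (j + 1) :=
  le_iSup (fun i : Fin (j + 1) => MeasurableSpace.comap (T.M D i) inferInstance
    ⊔ (MeasurableSpace.comap (T.F0 D i) inferInstance
      ⊔ MeasurableSpace.comap (T.F1 D i) inferInstance)) (Fin.last j)

variable (T D) in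
lemma past_succ_le (j : ℕ) : T.past D (j + 1) ≤ T.past D j ⊔
    (MeasurableSpace.comap (T.M D j) inferInstance
    ⊔ (MeasurableSpace.comap (T.F0 D j) inferInstance
      ⊔ MeasurableSpace.comap (T.F1 D j) inferInstance)) := by
  refine iSup_le fun i => ?_
  rcases Fin.lastCases (motive := fun i => i = Fin.last j ∨ ∃ i' : Fin j, i = i'.castSucc)
    (Or.inl rfl) (fun i' => Or.inr ⟨i', rfl⟩) i with rfl | ⟨i', rfl⟩
  · exact le_sup_right
  · exact le_sup_of_le_left (le_iSup (fun i : Fin j =>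
      MeasurableSpace.comap (T.M D i) inferInstance
      ⊔ (MeasurableSpace.comap (T.F0 D i) inferInstance
        ⊔ MeasurableSpace.comap (T.F1 D i) inferInstance)) i')

variable (T D) in
lemma pastHalf_le_past_succ (j : ℕ) : T.pastHalf D j ≤ T.past D (j + 1) :=
  sup_le (T.past_le_succ D j) (le_sup_left.trans (T.iteration_le_past_succ D j))

namespace IsRun

/-- Meant for the σ-algebra of the past, which contains the model values but need not contain the
ensembles. Hence the hypotheses speak only of `M`, `S`, `F0`, `F1` and `u`. -/
lemma measurableSet_success {j : ℕ}
    (hM : ∀ s, Measurable fun ω => T.M D j ω s) (hS : Measurable (T.S j))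
    (hF0 : Measurable (T.F0 D j)) (hF1 : Measurable (T.F1 D j))
    (hu : Measurable (T.u j)) : MeasurableSet {ω | T.Success D A j ω} := by
  -- The gradient is recovered from the model values, since the regularization has zero derivative
  -- at the zero step.
  have hg : Measurable (T.g D j) := measurable_of_hasGradientAt
    (fun ω => D.hasGradientAt_model (empCov_transpose D.zb (T.Zm j ω)) (T.X j ω) (T.u j ω)) hM
  -- Continuity in the step and measurability in `ω` give joint measurability, so a random step may
  -- be inserted.
  have hMS : Measurable fun ω => T.M D j ω (T.S j ω) := by
    have hc : ∀ ω, Continuous (T.M D j ω) := fun ω => D.continuous_model _ _ _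
    generalize T.M D j = F at hM hc
    generalize T.S j = S at hS
    have h1 : Measurable (Function.uncurry fun s ω => F ω s) :=
      measurable_uncurry_of_continuous_of_measurable hc hM
    exact h1.comp (hS.prodMk measurable_id)
  have hrho : Measurable (T.rho D j) := (hF0.sub hF1).div ((hM 0).sub hMS)
  exact (measurableSet_le measurable_const hrho).inter
    (measurableSet_le (hu.const_div _) hg.norm)

lemma measurable_M (hT : T.IsRun D A x0 P) {j : ℕ}
    (hX : Measurable (T.X j)) (hu : Measurable (T.u j)) :
    Measurable (T.M D j) :=
  measurable_pi_lambda _ fun s => D.measurable_model (hT.measurable_Zm j) hX hu s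

lemma pastHalf_le (hT : T.IsRun D A x0 P) {j : ℕ}
    (hp : T.past D j ≤ mΩ) (hX : Measurable[T.past D j] (T.X j))
    (hu : Measurable[T.past D j] (T.u j)) : T.pastHalf D j ≤ mΩ :=
  sup_le hp (hT.measurable_M (hX.mono hp le_rfl) (hu.mono hp le_rfl)).comap_le

lemma past_succ_le (hT : T.IsRun D A x0 P) {j : ℕ}
    (hp : T.past D j ≤ mΩ) (hX : Measurable[T.past D j] (T.X j))
    (hu : Measurable[T.past D j] (T.u j)) : T.past D (j + 1) ≤ mΩ := by
  have hX' := hX.mono hp le_rfl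
  have hS' := (hT.measurable_S j).mono (hT.pastHalf_le hp hX hu) le_rfl
  exact (Trajectory.past_succ_le D T j).trans (sup_le hp (sup_le
    (hT.measurable_M hX' (hu.mono hp le_rfl)).comap_le
    (sup_le (D.measurable_cost (hT.measurable_Zf j) hX').comap_le
      (D.measurable_cost (hT.measurable_Zf j) (hX'.add hS')).comap_le)))

/-- The iterate and the regularization parameter are determined by the past. -/
lemma measurable_past (hT : T.IsRun D A x0 P) (j : ℕ) :
    T.past D j ≤ mΩ ∧ Measurable[T.past D j] (T.X j) ∧
    Measurable[T.past D j] (T.u j) := by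
  induction j with
  | zero =>
    -- At `j = 0` the past is trivial, which is why the starting point and parameter must be
    -- deterministic.
    refine ⟨iSup_le fun i => i.elim0, ?_, ?_⟩
    · rw [funext hT.X_zero]; exact measurable_const
    · rw [funext hT.u_zero]; exact measurable_const
  | succ j ih =>
    obtain ⟨hp, hX, hu⟩ := ih
    have hle := T.past_le_succ D j
    have hit := T.iteration_le_past_succ D j
    have hX' : Measurable[T.past D (j + 1)] (T.X j) := hX.mono hle le_rfl
    have hu' : Measurable[T.past D (j + 1)] (T.u j) := hu.mono hle le_rfl
    have hS' : Measurable[T.past D (j + 1)] (T.S j) :=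
      (hT.measurable_S j).mono (T.pastHalf_le_past_succ D j) le_rfl
    have hM : Measurable[T.past D (j + 1)] (T.M D j) :=
      measurable_iff_comap_le.2 (le_sup_left.trans hit)
    have hF0 : Measurable[T.past D (j + 1)] (T.F0 D j) :=
      measurable_iff_comap_le.2 ((le_sup_left.trans le_sup_right).trans hit)
    have hF1 : Measurable[T.past D (j + 1)] (T.F1 D j) :=
      measurable_iff_comap_le.2 ((le_sup_right.trans le_sup_right).trans hit)
    have hsucc : MeasurableSet[T.past D (j + 1)] {ω | T.Success D A j ω} :=
      measurableSet_success (fun s => (measurable_pi_apply s).comp hM) hS' hF0 hF1 hu'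
    refine ⟨hT.past_succ_le hp hX hu, ?_, ?_⟩
    · rw [funext (hT.X_succ j)]
      exact Measurable.ite hsucc (hX'.add hS') hX'
    · rw [funext (hT.u_succ j)]
      exact Measurable.ite hsucc ((hu'.div_const _).max measurable_const) (hu'.const_mul _)

lemma u_pos (hT : T.IsRun D A x0 P) (j : ℕ) (ω : Ω) : 0 < T.u j ω := by
  induction j with
  | zero => rw [hT.u_zero]; exact A.muMin_pos.trans_le A.muMin_le_mu0
  | succ j ih =>
    rw [hT.u_succ]
    split_ifs
    · exact lt_max_of_lt_right A.muMin_pos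
    · exact mul_pos (zero_lt_one.trans A.one_lt_lam) ih

/-- One iteration multiplies the parameter by at most `λ`, and the floor `μ_min` is below `μ₀`. This
is the first entry of the minimum defining `c`. -/
lemma u_le (hT : T.IsRun D A x0 P) (j : ℕ) (ω : Ω) : T.u j ω ≤ A.lam ^ j * A.mu0 := by
  have h0 : 0 < A.mu0 := A.muMin_pos.trans_le A.muMin_le_mu0
  have h1 := A.one_lt_lam
  induction j with
  | zero => rw [hT.u_zero]; simp
  | succ j ih =>
    have h2 : T.u j ω ≤ A.lam ^ (j + 1) * A.mu0 := by
      refine ih.trans (mul_le_mul_of_nonneg_right ?_ h0.le)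
      exact pow_le_pow_right₀ h1.le (Nat.le_succ j)
    rw [hT.u_succ]
    split_ifs
    · refine max_le ((div_le_self (hT.u_pos j ω).le h1.le).trans h2) (A.muMin_le_mu0.trans ?_)
      exact le_mul_of_one_le_left h0.le (one_le_pow₀ h1.le)
    · rw [pow_succ', mul_assoc]
      exact mul_le_mul_of_nonneg_left ih (by linarith)

end IsRun

end Trajectory

end Run

/-! ### Union bound, positivity of the thresholds, and assembly -/

/-- Union bound over the two ways to fail. Truncated subtraction in `[0, ∞]` makes infinite bounds
harmless. -/
lemma one_sub_sub_le_measureReal {α : Type*} [MeasurableSpace α] {μ : Measure α}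
    [IsProbabilityMeasure μ] {S B₁ B₂ : Set α} {p q : ℝ≥0∞} (h : ∀ z, z ∉ S → z ∈ B₁ ∨ z ∈ B₂)
    (h₁ : μ B₁ ≤ p) (h₂ : μ B₂ ≤ q) : 1 - p - q ≤ ENNReal.ofReal (μ.real S) := by
  rw [ofReal_measureReal, tsub_tsub, tsub_le_iff_right]
  calc (1 : ℝ≥0∞) = μ Set.univ := measure_univ.symm
    _ ≤ μ (S ∪ (B₁ ∪ B₂)) := measure_mono fun z _ => by
        by_cases hz : z ∈ S
        · exact Or.inl hz
        · exact Or.inr (h z hz)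
    _ ≤ μ S + (μ B₁ + μ B₂) :=
        (measure_union_le _ _).trans (add_le_add le_rfl (measure_union_le _ _))
    _ ≤ μ S + (p + q) := by gcongr

namespace Problem

variable {n m N : ℕ} {D : Problem n m}

lemma aleph_nonneg {εf κef κeg c : ℝ} (hεf : 0 < εf) (x s : EuclideanSpace ℝ (Fin n)) :
    0 ≤ D.aleph εf κef κeg c x s :=
  le_max_of_le_left (le_max_of_le_left
    (div_nonneg (wsq_inv_nonneg D.Binf_posDef _) (by positivity)))

/-- The condition on `N` says `a c² n < N - 1 - n`, and the weighted norm is at most `2κa`; so the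
bias stays below `2κ / c²`. -/
lemma valueThreshold_pos {a κ c : ℝ} (hκ : 0 < κ) (hc : 0 < c) (hN : n + 1 < N)
    {x : EuclideanSpace ℝ (Fin n)} (ha : wsq D.Binf⁻¹ (x - D.zb) / (2 * κ) ≤ a)
    (h : (a * c ^ 2 + 1) * (n : ℝ) + 1 < N) : 0 < D.valueThreshold N κ c x := by
  have hN' : (n : ℝ) + 1 < N := by exact_mod_cast hN
  have hd : 0 < (N : ℝ) - 1 - n := by linarith
  rw [div_le_iff₀ (by positivity)] at ha
  rw [valueThreshold, sub_pos, div_mul_eq_mul_div, div_lt_div_iff₀ hd (by positivity)]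
  have hn : (0 : ℝ) ≤ n := n.cast_nonneg
  have h1 : (n : ℝ) * wsq D.Binf⁻¹ (x - D.zb) * c ^ 2 ≤ n * (a * (2 * κ)) * c ^ 2 := by gcongr
  have h2 : 2 * κ * (a * c ^ 2 * n) < 2 * κ * (N - 1 - n) := by
    apply mul_lt_mul_of_pos_left _ (by positivity)
    linarith
  linarith

/-- Here the gradient tolerance scales as `1/c`; the second factor `c` in `c²` is compensated by the
`c` in the denominator of the last entry of `ℵ`. -/
lemma gradThreshold_pos {a κ c : ℝ} (hκ : 0 < κ) (hc : 0 < c) (hN : n + 1 < N)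
    {x : EuclideanSpace ℝ (Fin n)} (ha : ‖mulE D.Binf⁻¹ (x - D.zb)‖ / (κ * c) ≤ a)
    (h : (a * c ^ 2 + 1) * (n : ℝ) + 1 < N) : 0 < D.gradThreshold N κ c x := by
  have hN' : (n : ℝ) + 1 < N := by exact_mod_cast hN
  have hd : 0 < (N : ℝ) - 1 - n := by linarith
  rw [div_le_iff₀ (by positivity)] at ha
  rw [gradThreshold, sub_pos, div_mul_eq_mul_div, div_lt_div_iff₀ hd hc]
  have hn : (0 : ℝ) ≤ n := n.cast_nonneg
  have h1 : (n : ℝ) * ‖mulE D.Binf⁻¹ (x - D.zb)‖ * c ≤ n * (a * (κ * c)) * c := by gcongr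
  have h2 : κ * (a * c ^ 2 * n) < κ * (N - 1 - n) := by
    apply mul_lt_mul_of_pos_left _ hκ
    linarith
  linarith

lemma cost_sub_f (B : Matrix (Fin n) (Fin n) ℝ) (x : EuclideanSpace ℝ (Fin n)) :
    D.cost B x - D.f x = (1 / 2) * wsq B⁻¹ (x - D.zb) - (1 / 2) * wsq D.Binf⁻¹ (x - D.zb) := by
  simp only [f, cost]
  ring

lemma model_zero (B : Matrix (Fin n) (Fin n) ℝ) (x : EuclideanSpace ℝ (Fin n)) (μ : ℝ) :
    D.model B x μ 0 = D.cost B x := by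
  simp [model, gnModel, cost]

variable (D) in
/-- The ensembles for which the function estimates at `x` and `x + s` are accurate, together with
the point, step and regularization parameter. -/
def accurateValues (N : ℕ) (εf : ℝ) : Set ((Fin N → EuclideanSpace ℝ (Fin n)) ×
    (EuclideanSpace ℝ (Fin n) × EuclideanSpace ℝ (Fin n) × ℝ)) :=
  {p | |D.cost (empCov D.zb p.1) p.2.1 - D.f p.2.1| ≤ εf / p.2.2.2 ^ 2 ∧
    |D.cost (empCov D.zb p.1) (p.2.1 + p.2.2.1) - D.f (p.2.1 + p.2.2.1)| ≤ εf / p.2.2.2 ^ 2}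

variable (D) in
/-- The ensembles for which the model at `x` is accurate, together with the point and
regularization parameter. -/
def accurateModels (N : ℕ) (κef κeg : ℝ) :
    Set ((Fin N → EuclideanSpace ℝ (Fin n)) × (EuclideanSpace ℝ (Fin n) × ℝ)) :=
  {p | ‖D.modelGrad (empCov D.zb p.1) p.2.1 - gradient D.f p.2.1‖ ≤ κeg / p.2.2 ∧
    |D.f p.2.1 - D.model (empCov D.zb p.1) p.2.1 p.2.2 0| ≤ κef / p.2.2 ^ 2}

lemma measurableSet_accurateValues (εf : ℝ) : MeasurableSet (D.accurateValues N εf) := by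
  have hx : Measurable fun p : (Fin N → EuclideanSpace ℝ (Fin n)) ×
    (EuclideanSpace ℝ (Fin n) × EuclideanSpace ℝ (Fin n) × ℝ) => p.2.1 := by fun_prop
  have hs : Measurable fun p : (Fin N → EuclideanSpace ℝ (Fin n)) ×
    (EuclideanSpace ℝ (Fin n) × EuclideanSpace ℝ (Fin n) × ℝ) => p.2.2.1 := by fun_prop
  have hu : Measurable fun p : (Fin N → EuclideanSpace ℝ (Fin n)) ×
    (EuclideanSpace ℝ (Fin n) × EuclideanSpace ℝ (Fin n) × ℝ) => εf / p.2.2.2 ^ 2 := by fun_prop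
  have hf := D.continuous_f.measurable
  exact (measurableSet_le ((D.measurable_cost measurable_fst hx).sub (hf.comp hx)).abs hu).inter
    (measurableSet_le ((D.measurable_cost measurable_fst (hx.add hs)).sub
      (hf.comp (hx.add hs))).abs hu)

lemma measurableSet_accurateModels (κef κeg : ℝ) :
    MeasurableSet (D.accurateModels N κef κeg) := by
  have hx : Measurable fun p : (Fin N → EuclideanSpace ℝ (Fin n)) ×
    (EuclideanSpace ℝ (Fin n) × ℝ) => p.2.1 := by fun_prop
  have hu : Measurable fun p : (Fin N → EuclideanSpace ℝ (Fin n)) ×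
    (EuclideanSpace ℝ (Fin n) × ℝ) => p.2.2 := by fun_prop
  have hgrad : Measurable (gradient D.f) := by
    rw [show gradient D.f = fun x => mulE D.Binf⁻¹ (x - D.zb) + D.obsGrad x from
      funext D.gradient_f_eq]
    exact (((continuous_mulE _).comp (continuous_id.sub continuous_const)).add
      D.continuous_obsGrad).measurable
  exact (measurableSet_le ((D.measurable_modelGrad measurable_fst hx).sub
      (hgrad.comp hx)).norm (hu.const_div _)).inter
    (measurableSet_le ((D.continuous_f.measurable.comp hx).sub
      (D.measurable_model measurable_fst hx hu 0)).abs ((hu.pow_const 2).const_div _))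

lemma le_measureReal_accurateValues (hN : n + 1 < N) {εf u c : ℝ} (hεf : 0 < εf) (hu : 0 < u)
    (huc : u ≤ c) {x s : EuclideanSpace ℝ (Fin n)} (h₀ : 0 < D.valueThreshold N εf c x)
    (h₁ : 0 < D.valueThreshold N εf c (x + s)) :
    1 - D.varNormSq N x / ENNReal.ofReal (D.valueThreshold N εf c x ^ 2)
        - D.varNormSq N (x + s) / ENNReal.ofReal (D.valueThreshold N εf c (x + s) ^ 2)
      ≤ ENNReal.ofReal ((D.ensembleLaw N).real {Z | (Z, x, s, u) ∈ D.accurateValues N εf}) := by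
  refine one_sub_sub_le_measureReal (fun Z hZ => ?_)
    (measure_wsq_deviation_le hN x hεf hu huc h₀)
    (measure_wsq_deviation_le hN (x + s) hεf hu huc h₁)
  by_contra! hcon
  refine hZ ⟨?_, ?_⟩
  · rw [cost_sub_f]; exact not_lt.1 hcon.1
  · rw [cost_sub_f]; exact not_lt.1 hcon.2

lemma le_measureReal_accurateModels (hN : n + 1 < N) {κef κeg u c : ℝ} (hκef : 0 < κef)
    (hκeg : 0 < κeg) (hu : 0 < u) (huc : u ≤ c) {x : EuclideanSpace ℝ (Fin n)}
    (h₀ : 0 < D.valueThreshold N κef c x) (h₁ : 0 < D.gradThreshold N κeg c x) :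
    1 - D.varNormSq N x / ENNReal.ofReal (D.valueThreshold N κef c x ^ 2)
        - (n : ℝ≥0∞) * D.lamMax N x / ENNReal.ofReal (D.gradThreshold N κeg c x ^ 2)
      ≤ ENNReal.ofReal ((D.ensembleLaw N).real {Z | (Z, x, u) ∈ D.accurateModels N κef κeg}) := by
  refine one_sub_sub_le_measureReal (fun Z hZ => ?_)
    (measure_wsq_deviation_le hN x hκef hu huc h₀)
    (measure_mulE_deviation_le hN x hκeg hu huc h₁)
  by_contra! hcon
  refine hZ ⟨?_, ?_⟩
  · rw [D.modelGrad_eq (empCov_transpose _ _), D.gradient_f_eq, add_sub_add_right_eq_sub]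
    exact not_lt.1 hcon.2
  · rw [model_zero, abs_sub_comm, cost_sub_f]; exact not_lt.1 hcon.1

end Problem

end EnsembleLM

/- The bounds are stated in `[0, ∞]`, where `1 - a - b ≤ t` means `1 ≤ t + a + b`; they are trivial
when a variance is infinite. The run stops at the first `i` with `u_i > μ_max`, so iteration `j` is
carried out exactly when `u_i ≤ μ_max` for all `i ≤ j`. -/
theorem corollary6p3 {Ω : Type*} [MeasurableSpace Ω] (P : Measure Ω) [IsProbabilityMeasure P]
    {n m N : ℕ} (D : EnsembleLM.Problem n m) (A : EnsembleLM.Params)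
    (x0 : EuclideanSpace ℝ (Fin n)) (T : EnsembleLM.Trajectory n N Ω) (hT : T.IsRun D A x0 P)
    (εf κef κeg μmax : ℝ) (hεf : 0 < εf) (hκef : 0 < κef) (hκeg : 0 < κeg)
    (j : ℕ) (c : ℝ) (hc : c = min (A.lam ^ j * A.mu0) μmax) :
    ∀ᵐ ω ∂P, (∀ i ≤ j, T.u i ω ≤ μmax) →
      (D.aleph εf κef κeg c (T.X j ω) (T.S j ω) * c ^ 2 + 1) * (n : ℝ) + 1 < (N : ℝ) →
      1 - D.varNormSq N (T.X j ω) / ENNReal.ofReal (D.valueThreshold N εf c (T.X j ω) ^ 2)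
          - D.varNormSq N (T.X j ω + T.S j ω)
              / ENNReal.ofReal (D.valueThreshold N εf c (T.X j ω + T.S j ω) ^ 2)
        ≤ ENNReal.ofReal (T.qStar D P εf j ω) ∧
      1 - D.varNormSq N (T.X j ω) / ENNReal.ofReal (D.valueThreshold N κef c (T.X j ω) ^ 2)
          - (n : ℝ≥0∞) * D.lamMax N (T.X j ω)
              / ENNReal.ofReal (D.gradThreshold N κeg c (T.X j ω) ^ 2)
        ≤ ENNReal.ofReal (T.pStar D P κef κeg j ω) := by
  obtain ⟨hp, hX, hu⟩ := hT.measurable_past j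
  have hph := hT.pastHalf_le hp hX hu
  have hle : T.past D j ≤ T.pastHalf D j := le_sup_left
  have hq := EnsembleLM.condExp_indicator_of_indep hph (hT.measurable_Zf j)
    ((hX.mono hle le_rfl).prodMk ((hT.measurable_S j).prodMk (hu.mono hle le_rfl)))
    (hT.indep_Zf j) (D.measurableSet_accurateValues (N := N) εf)
  have hpr := EnsembleLM.condExp_indicator_of_indep hp (hT.measurable_Zm j) (hX.prodMk hu)
    (hT.indep_Zm j) (D.measurableSet_accurateModels (N := N) κef κeg)
  rw [hT.law_Zf] at hq
  rw [hT.law_Zm] at hpr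
  filter_upwards [hq, hpr] with ω hqω hpω hμ hN
  have hu0 := hT.u_pos j ω
  -- Growth by at most `λ` per iteration gives one bound, the run not having stopped gives the
  -- other.
  have huc : T.u j ω ≤ c := hc ▸ le_min (hT.u_le j ω) (hμ j le_rfl)
  have hc0 : 0 < c := hu0.trans_le huc
  -- As `ℵ ≥ 0`, the condition on `N` already contains the dimension requirement for the inverse
  -- Wishart mean.
  have hNn : n + 1 < N := by
    have h := mul_nonneg (mul_nonneg (D.aleph_nonneg (κef := κef) (κeg := κeg) (c := c) hεf
      (T.X j ω) (T.S j ω)) (sq_nonneg c)) (n.cast_nonneg (α := ℝ))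
    have : (n : ℝ) + 1 < N := by linarith
    exact_mod_cast this
  have e1 : T.qStar D P εf j ω = _ := hqω
  have e2 : T.pStar D P κef κeg j ω = _ := hpω
  rw [e1, e2]
  -- Each of the four entries of `ℵ` secures the positivity of one threshold.
  exact ⟨D.le_measureReal_accurateValues hNn hεf hu0 huc
      (D.valueThreshold_pos hεf hc0 hNn ((le_max_left _ _).trans (le_max_left _ _)) hN)
      (D.valueThreshold_pos hεf hc0 hNn ((le_max_right _ _).trans (le_max_left _ _)) hN),
    D.le_measureReal_accurateModels hNn hκef hκeg hu0 huc
      (D.valueThreshold_pos hκef hc0 hNn ((le_max_left _ _).trans (le_max_right _ _)) hN)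
      (D.gradThreshold_pos hκeg hc0 hNn ((le_max_right _ _).trans (le_max_right _ _)) hN)⟩
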